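/- **Setting.** Let $d\ge 1$ and let $\|\cdot\|$ be a norm on $\mathbb R^d$ that is well-behaved: $\|e_i\|=\|e_j\|$ for all unit vectors, and $\overline B_{\infty}(q,2^{-(n+1)})\subseteq\overline B(q,2^{-n})$ for all $n\in\mathbb N$ and $q\in 2^{-n}\mathbb Z^d$. Here $B$ and $\overline B$ denote open and closed $\|\cdot\|$-balls. Let $\mathbb D$ be the set of dyadic rationals. A set $S\subseteq\mathbb R^d$ is a *bounded body* ($S\in\mathcal{KR}$) if it is nonempty, compact and equal to the closure of its interior; $\mathcal{KCR}$ is the class of convex bounded bodies. Names are total functions $\phi:\{0,1\}^*\to\{0,1\}^*$, asked about (codes of) pairs $(q,0^n)$ with $q\in\mathbb D^d$ in binary and an integer $n$ in unary; the space of names carries the product topology of the discrete topology. * $\phi$ is a $\delta_{\mathrm{wmem}}$-name of $S$ if all its values are $0$ or $1$, $\phi(q,0^n)=1$ whenever $\overline B(q,2^{-n})\subseteq S$, and $\phi(q,0^n)=0$ whenever $\overline B(q,2^{-n})\cap S=\emptyset$. * $\phi$ is a $\delta_{\mathrm{setrep}}$-name of $S$ if all its values are $0$ or $1$, $\phi(q,0^n)=1$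 whenever $B(q,2^{-n})\cap S\neq\emptyset$, and $\phi(q,0^n)=0$ whenever $\overline B(q,2^{-n+1})\cap S=\emptyset$. * $\phi$ is a $\delta_{\mathrm{dist}}$-name of $S$ if $\phi(q,0^n)$ is a dyadic number in $2^{-(n+1)}\mathbb Z$ with $|\phi(q,0^n)-\min_{x\in S}\|q-x\||\le 2^{-n}$. Advice parameters of $S$: $\mathsf a$ is any $a\in\mathbb D^d$ with $\overline B(a,\delta)\subseteq S$ for some $\delta>0$ (in binary); $\mathsf r$ is any $r\in\mathbb Z$ such that $\overline B(x,2^{-r})\subseteq S$ for some $x$ (in unary); $\mathsf b$ is any $b\in\mathbb Z$ with $S\subseteq\overline B(0,2^b)$ (in unary); $\mathsf{ar}$ is any pair $(a,r)$ with $B(a,2^{-r})\subseteq S$. A $\delta\langle \mathsf E\rangle$-name of $S$ is a pair of a $\delta$-name of $S$ and a value of $\mathsf E$ for $S$. A multi-valued operation is computable (continuous) with respect to given representations of arguments and results if some oracle Turing machine (some continuous map) sends each name of an argument $S$ to a name of some admissible value for $S$; one reduces $\delta$ to $\delta'$ by computing the identity. It is computable in polynomial time if moreover there are polynomials $\tau,t$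 such that the machine, on each name and each discrete input $s$, halts within $\tau(\ell)\cdot t(|s|)$ steps, where $\ell$ is the total length of the advice in the name ($\ell=0$ if there is none). An advice parameter is computed by writing out its whole code. **Proposition.** 0. The operation $\mathsf{Bound}:\mathcal{KR}\rightrightarrows\mathbb Z$, $S\mapsto\{b\in\mathbb Z: S\subseteq\overline B(0,2^b)\}$, with values given in unary, is discontinuous with respect to $\delta_{\mathrm{wmem}}\langle\mathsf{ar}\rangle$, and also with respect to $\delta_{\mathrm{setrep}}\langle\mathsf{ar}\rangle$. 1. On $\mathcal{KR}$, $\delta_{\mathrm{wmem}}\langle\mathsf{ar}\rangle\langle\mathsf b\rangle$ does not computably reduce to $\delta_{\mathrm{dist}}$. 2. On $\mathcal{KCR}$, for every permutation $\chi_1,\chi_2,\chi_3$ of $\mathsf a,\mathsf r,\mathsf b$, the parameter $\chi_3$ is not computable in polynomial time from $\delta_{\mathrm{wmem}}\langle\chi_1\rangle\langle\chi_2\rangle$. 3. On $\mathcal{KCR}$, each of $\mathsf a$, $\mathsf r$, $\mathsf b$ is computable from $\delta_{\mathrm{setrep}}$, but none of them is computable from $\delta_{\mathrm{setrep}}$ in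 polynomial time. -/

import Mathlib

namespace SetRep

/-! ### Words, string functions and their encodings -/

/-- Finite words over the binary alphabet; `false` is the letter 0 and `true` is the letter 1. -/
abbrev Word := List Bool

/-- Total functions from words to words.  They carry the product topology of the discrete
topology on words (see `discreteTopology_word`). -/
abbrev StrFun := Word → Word

theorem discreteTopology_word : DiscreteTopology Word := inferInstance

/-- The bijective binary coding of the natural numbers by words (least significant digit first;
the letters 0 and 1 stand for the digits 1 and 2). -/
def natToWord : ℕ → Word
  | 0 => []
  | n + 1 => (n % 2 == 1) :: natToWord (n / 2)
  decreasing_by omega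

/-- The inverse of `natToWord`. -/
def wordToNat : Word → ℕ
  | [] => 0
  | b :: w => 2 * wordToNat w + (if b then 2 else 1)

/-- The Cantor pairing function. -/
def cantorPair (x y : ℕ) : ℕ := (x + y) * (x + y + 1) / 2 + y

/-- The pairing function on words. -/
def wordPair (s t : Word) : Word := natToWord (cantorPair (wordToNat s) (wordToNat t))

/-- The embedding of the integers into the natural numbers. -/
def intCode (k : ℤ) : ℕ := Equiv.intEquivNat k

/-- Binary coding of integers. -/
def binInt (k : ℤ) : Word := natToWord (intCode k)

/-- Unary coding of integers; a precision, an inner or an outer radius parameter is given so. -/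
def unInt (k : ℤ) : Word := List.replicate (intCode k) false

/-- The code of the dyadic rational `a / 2 ^ n`, given as the pair `(a, n)`. -/
def dyCode (p : ℤ × ℕ) : Word := wordPair (binInt p.1) (List.replicate p.2 false)

/-- The dyadic rational `a / 2 ^ n` given by the pair `(a, n)`. -/
noncomputable def dyVal (p : ℤ × ℕ) : ℝ := (p.1 : ℝ) / 2 ^ p.2

/-- Codes of nonempty tuples of dyadic rationals. -/
def dyListCode : List (ℤ × ℕ) → Word
  | [] => []
  | [p] => dyCode p
  | p :: q :: l => wordPair (dyCode p) (dyListCode (q :: l))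

/-- The code of the dyadic point whose coordinates are given by the pairs `p i`. -/
def ptCode {d : ℕ} (p : Fin d → ℤ × ℕ) : Word := dyListCode (List.ofFn p)

/-- The dyadic point whose coordinates are given by the pairs `p i`. -/
noncomputable def ptVal {d : ℕ} (p : Fin d → ℤ × ℕ) : Fin d → ℝ := fun i => dyVal (p i)

/-- The word by which a name is asked about a dyadic point at integer precision `n`. -/
def queryCode {d : ℕ} (p : Fin d → ℤ × ℕ) (n : ℤ) : Word := wordPair (ptCode p) (unInt n)

/-- The pairing function on string functions. -/
def strPair (φ ψ : StrFun) : StrFun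
  | [] => []
  | false :: s => List.replicate (ψ s).length false ++ true :: φ s
  | true :: s => List.replicate (φ s).length false ++ true :: ψ s

/-! ### Oracle Turing machines -/

/-- Alphabets of the stacks of a machine: three binary stacks (input, output, query), and work
stacks with arbitrary alphabets. -/
def stackAlph {K : Type} (Γ : K → Type) : Fin 3 ⊕ K → Type
  | Sum.inl _ => Bool
  | Sum.inr k => Γ k

/-- Deterministic function-oracle Turing machines, built on Mathlib's multi-stack Turing machines
`Turing.TM2` (a two-sided tape is a pair of stacks; one step executes one straight-line program,
which takes a bounded number of stack operations): finitely many stacks, finite alphabets,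
finitely many labels `Λ` and a finite internal memory `σ`.  The state `ask` initiates a query, the
state `resume` marks that the answer has been written. -/
structure OracleTM where
  K : Type
  [decEqK : DecidableEq K]
  [finK : Finite K]
  Γ : K → Type
  [finΓ : ∀ k, Finite (Γ k)]
  Λ : Type
  [decEqΛ : DecidableEq Λ]
  [finΛ : Finite Λ]
  σ : Type
  [finσ : Finite σ]
  start : Λ
  ask : Λ
  resume : Λ
  mem : σ
  prog : Λ → Turing.TM2.Stmt (stackAlph Γ) Λ σ

namespace OracleTM

attribute [instance] decEqK finK finΓ decEqΛ finΛ finσ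

/-- Configurations: current label (`none` if the machine has halted), memory, and stacks. -/
abbrev Cfg (M : OracleTM) : Type := Turing.TM2.Cfg (stackAlph M.Γ) M.Λ M.σ

/-- The initial configuration: the input word is on the input stack (first letter on top), all
other stacks are empty. -/
def init (M : OracleTM) (s : Word) : M.Cfg where
  l := some M.start
  var := M.mem
  stk := Function.update (fun _ => []) (Sum.inl 0) (s : List Bool)

/-- One step with oracle `φ`.  In state `ask` the content `u` of the query stack is replaced by
`φ u`; this counts as a single step.  A machine that has halted stays as it is. -/
def step (M : OracleTM) (φ : StrFun) (c : M.Cfg) : M.Cfg :=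
  match c.l with
  | none => c
  | some l =>
    if l = M.ask then
      { l := some M.resume
        var := c.var
        stk := Function.update c.stk (Sum.inl 2) (φ (c.stk (Sum.inl 2)) : List Bool) }
    else Turing.TM2.stepAux (M.prog l) c.var c.stk

/-- With oracle `φ` and input `s`, the machine halts within `t` steps with the word `w` on its
output stack. -/
def OutputsWithin (M : OracleTM) (φ : StrFun) (s w : Word) (t : ℕ) : Prop :=
  ((M.step φ)^[t] (M.init s)).l = none ∧ ((M.step φ)^[t] (M.init s)).stk (Sum.inl 1) = w

/-- With oracle `φ` and input `s`, the machine halts with output `w`. -/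
def Outputs (M : OracleTM) (φ : StrFun) (s w : Word) : Prop := ∃ t, M.OutputsWithin φ s w t

end OracleTM

/-! ### Representations, enrichments, realizers -/

/-- A (second-order) representation.  `IsName φ x ℓ` says that `φ` is a name of `x` and that the
discrete advice which `φ` carries has total length `ℓ` (so `ℓ = 0` without enrichment). -/
structure Rep (X : Type) where
  IsName : StrFun → X → ℕ → Prop

/-- Restriction of a representation to the objects of a class `C`. -/
def Rep.restrict {X : Type} (ρ : Rep X) (C : Set X) : Rep X where
  IsName φ x ℓ := x ∈ C ∧ ρ.IsName φ x ℓ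

/-- The representation of words: the constant string function `w` names the word `w`. -/
def wordRep : Rep Word where
  IsName φ w ℓ := (∀ s, φ s = w) ∧ ℓ = 0

/-- The enrichment of a representation `ρ` by the multi-valued function `E`: a name is a pair of a
`ρ`-name of `x` and a name of an element of `E x`. -/
def Rep.enrich {X : Type} (ρ : Rep X) (E : X → Set Word) : Rep X where
  IsName φ x ℓ := ∃ (φ₁ φ₂ : StrFun) (w : Word) (ℓ₁ : ℕ),
    φ = strPair φ₁ φ₂ ∧ ρ.IsName φ₁ x ℓ₁ ∧ wordRep.IsName φ₂ w 0 ∧ w ∈ E x ∧ ℓ = ℓ₁ + w.length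

/-- The letter at position `i` of the sequence `(0 1)^k 1^ω`. -/
def unaryBit (k i : ℕ) : Bool := if i < 2 * k then i % 2 == 1 else true

/-- The unary representation of the integers, induced by the sequences `(0 1)^k 1^ω`: a name
answers a word `s` with the letter at position `|s|`. -/
def unaryRep : Rep ℤ where
  IsName φ k ℓ := (∀ s, φ s = [unaryBit (intCode k) s.length]) ∧ ℓ = 0

/-- `φ` is a `ρ`-name of a point at which the multi-valued function `f` is defined, with advice of
length `ℓ`. -/
def InDom {X Y : Type} (ρ : Rep X) (f : X → Set Y) (φ : StrFun) (ℓ : ℕ) : Prop :=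
  ∃ x, ρ.IsName φ x ℓ ∧ (f x).Nonempty

/-- `g` is a `(ρ, ρ')`-realizer of the multi-valued function `f`. -/
def IsRealizer {X Y : Type} (ρ : Rep X) (ρ' : Rep Y) (f : X → Set Y) (g : StrFun → StrFun) :
    Prop :=
  ∀ φ x ℓ, ρ.IsName φ x ℓ → (f x).Nonempty → ∃ y ∈ f x, ∃ ℓ', ρ'.IsName (g φ) y ℓ'

/-- `f` is `(ρ, ρ')`-continuous. -/
def IsContinuous {X Y : Type} (ρ : Rep X) (ρ' : Rep Y) (f : X → Set Y) : Prop :=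
  ∃ g : StrFun → StrFun, IsRealizer ρ ρ' f g ∧ ContinuousOn g {φ | ∃ ℓ, InDom ρ f φ ℓ}

/-- `f` is `(ρ, ρ')`-computable. -/
def IsComputable {X Y : Type} (ρ : Rep X) (ρ' : Rep Y) (f : X → Set Y) : Prop :=
  ∃ (g : StrFun → StrFun) (M : OracleTM), IsRealizer ρ ρ' f g ∧
    ∀ φ ℓ, InDom ρ f φ ℓ → ∀ s, M.Outputs φ s (g φ s)

/-- `f` is (fully) polynomial-time `(ρ, ρ')`-computable: the number of steps is at most
`τ ℓ * t |s|` for polynomials `τ` and `t`, where `ℓ` is the length of the advice in the name. -/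
def IsPolyTime {X Y : Type} (ρ : Rep X) (ρ' : Rep Y) (f : X → Set Y) : Prop :=
  ∃ (g : StrFun → StrFun) (M : OracleTM) (τ t : Polynomial ℕ), IsRealizer ρ ρ' f g ∧
    ∀ φ ℓ, InDom ρ f φ ℓ → ∀ s, M.OutputsWithin φ s (g φ s) (τ.eval ℓ * t.eval s.length)

/-- `ρ` translates (reduces) to `ρ'`: the identity is `(ρ, ρ')`-computable. -/
def Reduces {X : Type} (ρ ρ' : Rep X) : Prop := IsComputable ρ ρ' (fun x => {x})

/-! ### Classes of sets and representations of sets -/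

/-- Norms on `ℝ^d` that are well-behaved: all unit vectors have the same length, and balls are not
too small compared with those of the maximum norm. -/
structure WellBehaved {d : ℕ} (N : Seminorm ℝ (Fin d → ℝ)) : Prop where
  definite : ∀ x, N x = 0 → x = 0
  unit_vectors : ∀ i j : Fin d, N (Pi.single i 1) = N (Pi.single j 1)
  balls : ∀ (n : ℕ) (q : Fin d → ℤ), let x : Fin d → ℝ := fun i => (q i : ℝ) / 2 ^ n
    Metric.closedBall x ((2 : ℝ) ^ (-((n : ℤ) + 1))) ⊆ N.closedBall x ((2 : ℝ) ^ (-(n : ℤ)))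

/-- Closed nonempty sets. -/
def closedSets (d : ℕ) : Set (Set (Fin d → ℝ)) := {S | IsClosed S ∧ S.Nonempty}

/-- Regular sets: closed nonempty sets that are the closure of their interior. -/
def regularSets (d : ℕ) : Set (Set (Fin d → ℝ)) := {S | S ∈ closedSets d ∧ closure (interior S) = S}

/-- Bounded bodies: compact regular sets. -/
def KR (d : ℕ) : Set (Set (Fin d → ℝ)) := {S | S ∈ regularSets d ∧ IsCompact S}

/-- Bounded convex bodies. -/
def KCR (d : ℕ) : Set (Set (Fin d → ℝ)) := {S | S ∈ KR d ∧ Convex ℝ S}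

section

variable {d : ℕ} (N : Seminorm ℝ (Fin d → ℝ))

/-- The weak-membership representation of regular sets (names are predicates). -/
def wmemRep : Rep (Set (Fin d → ℝ)) where
  IsName φ S ℓ := S ∈ regularSets d ∧ ℓ = 0 ∧ (∀ s, φ s = [true] ∨ φ s = [false]) ∧
    ∀ (p : Fin d → ℤ × ℕ) (n : ℤ),
      (N.closedBall (ptVal p) ((2 : ℝ) ^ (-n)) ⊆ S → φ (queryCode p n) = [true]) ∧
      (Disjoint (N.closedBall (ptVal p) ((2 : ℝ) ^ (-n))) S → φ (queryCode p n) = [false])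

/-- The set representation of closed nonempty sets (names are predicates). -/
def setRep : Rep (Set (Fin d → ℝ)) where
  IsName φ S ℓ := S ∈ closedSets d ∧ ℓ = 0 ∧ (∀ s, φ s = [true] ∨ φ s = [false]) ∧
    ∀ (p : Fin d → ℤ × ℕ) (n : ℤ),
      ((N.ball (ptVal p) ((2 : ℝ) ^ (-n)) ∩ S).Nonempty → φ (queryCode p n) = [true]) ∧
      (Disjoint (N.closedBall (ptVal p) ((2 : ℝ) ^ (-n + 1))) S → φ (queryCode p n) = [false])

/-- The distance of a point to a set. -/
noncomputable def distTo (S : Set (Fin d → ℝ)) (q : Fin d → ℝ) : ℝ :=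
  sInf ((fun x => N (q - x)) '' S)

/-- The representation of closed nonempty sets by their distance function: a name answers a query
at precision `n` with a dyadic rational of precision `n + 1`. -/
def distRep : Rep (Set (Fin d → ℝ)) where
  IsName φ S ℓ := S ∈ closedSets d ∧ ℓ = 0 ∧
    ∀ (p : Fin d → ℤ × ℕ) (n : ℤ), ∃ v : ℤ × ℕ, φ (queryCode p n) = dyCode v ∧
      (∃ z : ℤ, dyVal v = (z : ℝ) / (2 : ℝ) ^ (n + 1)) ∧
      |dyVal v - distTo N S (ptVal p)| ≤ (2 : ℝ) ^ (-n)

/-- The integers `b` for which `2 ^ b` is an outer radius. -/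
def Bound (S : Set (Fin d → ℝ)) : Set ℤ := {b | S ⊆ N.closedBall 0 ((2 : ℝ) ^ b)}

/-- Enrichment by an outer radius parameter, in unary. -/
def enrB (S : Set (Fin d → ℝ)) : Set Word := {w | ∃ b ∈ Bound N S, w = unInt b}

/-- Enrichment by an inner radius parameter, in unary. -/
def enrR (S : Set (Fin d → ℝ)) : Set Word :=
  {w | ∃ r : ℤ, (∃ x ∈ interior S, N.closedBall x ((2 : ℝ) ^ (-r)) ⊆ S) ∧ w = unInt r}

/-- Enrichment by a dyadic inner point, in binary. -/
def enrA (S : Set (Fin d → ℝ)) : Set Word :=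
  {w | ∃ p : Fin d → ℤ × ℕ, (∃ δ > 0, N.closedBall (ptVal p) δ ⊆ S) ∧ w = ptCode p}

/-- Enrichment by an inner ball. -/
def enrAR (S : Set (Fin d → ℝ)) : Set Word :=
  {w | ∃ (p : Fin d → ℤ × ℕ) (r : ℤ), N.ball (ptVal p) ((2 : ℝ) ^ (-r)) ⊆ S ∧
    w = wordPair (ptCode p) (unInt r)}

end

/-- The three advice parameters: inner point, inner radius, outer radius. -/
inductive Advice
  | a
  | r
  | b

/-- The enrichment that belongs to an advice parameter. -/
def Advice.enr {d : ℕ} (N : Seminorm ℝ (Fin d → ℝ)) : Advice → Set (Fin d → ℝ) → Set Word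
  | Advice.a => enrA N
  | Advice.r => enrR N
  | Advice.b => enrB N

end SetRep

open SetRep

/-! The negative results rest on how little of a name is inspected. For continuity and for
computability, the closed unit ball is compared with its union with a second, remote ball. Weak
membership overlooks the second ball if it is small: a queried ball is connected, hence contained in
the union only if it lies in one of the two parts, and it is too large for the small one
(`wname_union_closedBall`). The set representation overlooks the second ball if it lies beyond all
queried balls (`sname_union_closedBall`). One letter of a unary name already bounds the integer
named, so outer radii are discontinuous (`not_isContinuous_bound`); and the distance to the centre
of the overlooked ball jumps to 0 (`not_reduces_dist`).

For the time bounds, names with advice of fixed length leave a machine a fixed number of steps on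
the empty input, hence outputs of bounded length, whereas the radius parameters of growing or
shrinking balls need long codes. An inner point is hard to find even if both radius parameters are
known: among exponentially many disjoint small balls, an oracle that denies everything lets each
query, and the final output, exclude at most one ball (`not_isPolyTime_point`).

The computability results are unbounded searches for a certificate consisting of finitely many
answers (`isComputable_of_search`). An inner ball is certified by positive answers near the vertices
of a cross-polytope: a hyperplane that cuts off a point of the ball would cut off a vertex too far
(`closedBall_subset_of_near_vertices`). An outer radius is certified by a positive answer at the
origin and negative answers that cover the boundary of a cube: a convex set is connected and cannot
cross that boundary. The search machine alternates queries with evaluations of a fixed primitive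
recursive function (`exists_iterating_machine`). -/

namespace SetRep

open Turing Turing.PartrecToTM2 Turing.ToPartrec

/-! ### Runs of oracle machines -/

namespace OracleTM

/-- `c'` is reached from `c` after finitely many steps. -/
def Reach (M : OracleTM) (φ : StrFun) (c c' : M.Cfg) : Prop := ∃ t, (M.step φ)^[t] c = c'

theorem Reach.refl {M : OracleTM} {φ : StrFun} (c : M.Cfg) : M.Reach φ c c := ⟨0, rfl⟩

theorem Reach.trans {M : OracleTM} {φ : StrFun} {a b c : M.Cfg} (h : M.Reach φ a b)
    (h' : M.Reach φ b c) : M.Reach φ a c := by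
  obtain ⟨s, rfl⟩ := h
  obtain ⟨t, rfl⟩ := h'
  exact ⟨t + s, Function.iterate_add_apply ..⟩

theorem Reach.head {M : OracleTM} {φ : StrFun} {a b c : M.Cfg} (h : M.step φ a = b)
    (h' : M.Reach φ b c) : M.Reach φ a c :=
  Reach.trans ⟨1, h⟩ h'

end OracleTM

/-! ### Embedding the partial recursive functions -/

instance finite_partrecStack : Finite K' :=
  Finite.of_surjective (fun i : Fin 4 => match i with
    | 0 => K'.main | 1 => K'.rev | 2 => K'.aux | 3 => K'.stack)
    (fun k => by cases k; exacts [⟨0, rfl⟩, ⟨1, rfl⟩, ⟨2, rfl⟩, ⟨3, rfl⟩])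

/-- The stack alphabets of the search machines. -/
abbrev PStk : Fin 3 ⊕ K' → Type := stackAlph (fun _ : K' => Γ')

/-- Stacks given by the three binary stacks and the work stacks. -/
def joinStk (B : Fin 3 → List Bool) (S : K' → List Γ') : ∀ k, List (PStk k)
  | Sum.inl i => B i
  | Sum.inr k => S k

theorem joinStk_update_inr (B : Fin 3 → List Bool) (S : K' → List Γ') (k : K') (x : List Γ') :
    Function.update (joinStk B S) (Sum.inr k) x = joinStk B (Function.update S k x) := by
  funext j
  rcases j with j | j
  · exact Function.update_of_ne (by simp) _ _
  · by_cases h : j = k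
    · subst h
      exact (Function.update_self ..).trans (Function.update_self j x S).symm
    · have e : S j = Function.update S k x j := (Function.update_of_ne h x S).symm
      exact (Function.update_of_ne (by simpa using h) _ _).trans e

theorem joinStk_update_inl (B : Fin 3 → List Bool) (S : K' → List Γ') (k : Fin 3)
    (x : List Bool) :
    Function.update (joinStk B S) (Sum.inl k) x = joinStk (Function.update B k x) S := by
  funext j
  rcases j with j | j
  · by_cases h : j = k
    · subst h
      exact (Function.update_self ..).trans (Function.update_self j x B).symm
    · have e : B j = Function.update B k x j := (Function.update_of_ne h x B).symm
      exact (Function.update_of_ne (by simpa using h) _ _).trans e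
  · exact Function.update_of_ne (by simp) _ _

section Lift

variable {Λ : Type} (f : Λ' → Λ) (h : Λ)

/-- Relabelling of a program, where the halting statement is replaced by a jump to `h`. -/
def liftStmt : TM2.Stmt (fun _ : K' => Γ') Λ' (Option Γ') → TM2.Stmt PStk Λ (Option Γ')
  | .push k g q => .push (Sum.inr k) g (liftStmt q)
  | .peek k g q => .peek (Sum.inr k) g (liftStmt q)
  | .pop k g q => .pop (Sum.inr k) g (liftStmt q)
  | .load g q => .load g (liftStmt q)
  | .branch g q₁ q₂ => .branch g (liftStmt q₁) (liftStmt q₂)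
  | .goto g => .goto (fun v => f (g v))
  | .halt => .goto (fun _ => h)

/-- Relabelling of a configuration. -/
def liftCfg (B : Fin 3 → List Bool) (c : TM2.Cfg (fun _ : K' => Γ') Λ' (Option Γ')) :
    TM2.Cfg PStk Λ (Option Γ') :=
  ⟨some (c.l.elim h f), c.var, joinStk B c.stk⟩

/-- The lifted program only touches work stacks, so the three binary stacks `B` are carried along as
a parameter. -/
theorem stepAux_liftStmt (B : Fin 3 → List Bool)
    (q : TM2.Stmt (fun _ : K' => Γ') Λ' (Option Γ')) (v : Option Γ') (S : K' → List Γ') :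
    TM2.stepAux (liftStmt f h q) v (joinStk B S) = liftCfg f h B (TM2.stepAux q v S) := by
  induction q generalizing v S with
  | push k g q ih =>
    simp only [liftStmt, TM2.stepAux]
    rw [← ih, ← joinStk_update_inr]; rfl
  | peek k g q ih =>
    simp only [liftStmt, TM2.stepAux]
    rw [← ih]; rfl
  | pop k g q ih =>
    simp only [liftStmt, TM2.stepAux]
    rw [← ih, ← joinStk_update_inr]; rfl
  | load g q ih => simp only [liftStmt, TM2.stepAux, ih]
  | branch g q₁ q₂ ih₁ ih₂ =>
    simp only [liftStmt, TM2.stepAux]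
    cases g v <;> simp [ih₁, ih₂]
  | goto g => rfl
  | halt => rfl

end Lift

/-- The control labels of the search machines. -/
inductive Ctl
  | start
  | ask
  | resume
  | flag
  | rd (b : Bool)
  | wr (b : Bool)

instance finite_ctl : Finite Ctl :=
  Finite.of_surjective (fun i : Fin 4 ⊕ Bool × Bool => match i with
    | Sum.inl 0 => Ctl.start | Sum.inl 1 => Ctl.ask | Sum.inl 2 => Ctl.resume
    | Sum.inl 3 => Ctl.flag | Sum.inr (true, b) => Ctl.rd b | Sum.inr (false, b) => Ctl.wr b)
    (fun k => by
      cases k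
      exacts [⟨Sum.inl 0, rfl⟩, ⟨Sum.inl 1, rfl⟩, ⟨Sum.inl 2, rfl⟩, ⟨Sum.inl 3, rfl⟩,
        ⟨Sum.inr (true, _), rfl⟩, ⟨Sum.inr (false, _), rfl⟩])

/-! ### Programs of the search machine and its digit format -/

section Search

open TM2.Stmt

/-- The digit that stands for a letter. -/
def bitG (b : Bool) : Γ' := if b then Γ'.bit1 else Γ'.bit0

/-- Is the symbol a digit? -/
def isDigit : Option Γ' → Bool
  | some Γ'.bit0 => true
  | some Γ'.bit1 => true
  | _ => false

/-- The labels that are used in the evaluation of a code. -/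
noncomputable abbrev codeLabels (c : Code) : Finset Λ' := codeSupp c Cont'.halt

/-- The labels of the search machine. -/
abbrev SLab (c : Code) : Type := {l : Λ' // l ∈ codeLabels c} ⊕ Ctl

open Classical in
/-- The label of the search machine for a label of the evaluation. -/
noncomputable def slab (c : Code) (l : Λ') : SLab c :=
  if h : l ∈ codeLabels c then Sum.inl ⟨l, h⟩ else Sum.inr Ctl.start

/-- The programs of the search machine. -/
noncomputable def searchProg (c : Code) : SLab c → TM2.Stmt PStk (SLab c) (Option Γ')
  | Sum.inl l => liftStmt (slab c) (Sum.inr Ctl.flag) (tr l.1)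
  | Sum.inr Ctl.start =>
    push (Sum.inr K'.main) (fun _ => Γ'.cons) <| push (Sum.inr K'.main) (fun _ => Γ'.bit1) <|
      load (fun _ => none) <| goto fun _ => slab c (trNormal c Cont'.halt)
  | Sum.inr Ctl.ask => halt
  | Sum.inr Ctl.resume =>
    pop (Sum.inl 2) (fun _ (a : Option Bool) => a.map bitG) <|
      push (Sum.inr K'.main) (fun v => v.getD Γ'.bit0) <|
      load (fun _ => none) <| goto fun _ => slab c (trNormal c Cont'.halt)
  | Sum.inr Ctl.flag =>
    pop (Sum.inr K'.main) (fun _ a => a) <|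
      goto fun v => Sum.inr (Ctl.rd (decide (v = some Γ'.bit1)))
  | Sum.inr (Ctl.rd b) =>
    pop (Sum.inr K'.main) (fun _ a => a) <|
      branch isDigit
        (push (Sum.inr K'.rev) (fun v => v.getD Γ'.bit0) <| goto fun _ => Sum.inr (Ctl.rd b))
        (pop (Sum.inr K'.rev) (fun _ a => a) <| goto fun _ => Sum.inr (Ctl.wr b))
  | Sum.inr (Ctl.wr b) =>
    pop (Sum.inr K'.rev) (fun _ a => a) <|
      branch isDigit
        (push (Sum.inl (if b then 1 else 2)) (fun v => (decide (v = some Γ'.bit1) : Bool)) <|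
          goto fun _ => Sum.inr (Ctl.wr b))
        (cond b halt (goto fun _ => Sum.inr Ctl.ask))

open Classical in
/-- The search machine of a code. -/
noncomputable def searchTM (c : Code) : OracleTM where
  K := K'
  Γ := fun _ => Γ'
  Λ := SLab c
  σ := Option Γ'
  start := Sum.inr Ctl.start
  ask := Sum.inr Ctl.ask
  resume := Sum.inr Ctl.resume
  mem := none
  prog := searchProg c

theorem natToWord_succ (n : ℕ) : natToWord (n + 1) = (n % 2 == 1) :: natToWord (n / 2) := by
  rw [natToWord]

theorem trNat_bit (b : Bool) (n : ℕ) (hn : n ≠ 0) :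
    trNat (2 * n + b.toNat) = bitG b :: trNat n := by
  obtain ⟨p, hp⟩ : ∃ p : PosNum, (n : Num) = Num.pos p := by
    cases h : (n : Num) with
    | zero =>
      exfalso; apply hn
      have := congrArg (fun x : Num => (x : ℕ)) h
      simpa using this
    | pos p => exact ⟨p, rfl⟩
  have e : ((2 * n + b.toNat : ℕ) : Num) = Num.pos (cond b p.bit1 p.bit0) := by
    apply Num.to_nat_inj.1
    have hp' : (p : ℕ) = n := by
      have := congrArg (fun x : Num => (x : ℕ)) hp
      simpa using this.symm
    rw [Num.to_of_nat]
    cases b <;> simp [hp'] <;> omega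
  rw [trNat, trNat, e, hp]
  cases b <;> rfl

/-- Bijective numeration is ordinary binary in disguise: the letters of the word of `n` are the
binary digits of `n + 1` without the leading 1. This lets words be read off the work stack of an
evaluator for numbers. -/
theorem trNat_succ_eq (n : ℕ) :
    trNat (n + 1) = (natToWord n).map bitG ++ [Γ'.bit1] := by
  induction n using Nat.strong_induction_on with
  | _ n ih =>
    rcases n with _ | n
    · rw [natToWord]; rfl
    · rw [natToWord_succ, List.map_cons, List.cons_append, ← ih _ (by omega),
        ← trNat_bit _ _ (Nat.succ_ne_zero _)]
      congr 1
      rcases Nat.mod_two_eq_zero_or_one n with h | h <;> simp [h] <;> omega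

end Search

end SetRep

namespace SetRep

open Turing Turing.PartrecToTM2 Turing.ToPartrec

/-! ### Correctness of the runs of the search machine -/

section SearchRun

open TM2.Stmt

section

variable {Λ : Type} (B : Fin 3 → List Bool) (S : K' → List Γ') (v : Option Γ')
  (q : TM2.Stmt PStk Λ (Option Γ')) (m r : List Γ')

theorem stepAux_push_inl (k : Fin 3) (f : Option Γ' → Bool) :
    TM2.stepAux (push (Sum.inl k) f q) v (joinStk B S) =
      TM2.stepAux q v (joinStk (Function.update B k (f v :: B k)) S) :=
  congrArg (TM2.stepAux q v) (joinStk_update_inl B S k _)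

theorem stepAux_pop_inl (k : Fin 3) (f : Option Γ' → Option Bool → Option Γ') :
    TM2.stepAux (pop (Sum.inl k) f q) v (joinStk B S) =
      TM2.stepAux q (f v (B k).head?) (joinStk (Function.update B k (B k).tail) S) :=
  congrArg (TM2.stepAux q _) (joinStk_update_inl B S k _)

theorem stepAux_branch_true {p : Option Γ' → Bool} {v : Option Γ'} (h : p v = true)
    (q q' : TM2.Stmt PStk Λ (Option Γ')) (T : ∀ k, List (PStk k)) :
    TM2.stepAux (branch p q q') v T = TM2.stepAux q v T := by
  rw [TM2.stepAux, h, cond_true]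

theorem stepAux_branch_false {p : Option Γ' → Bool} {v : Option Γ'} (h : p v = false)
    (q q' : TM2.Stmt PStk Λ (Option Γ')) (T : ∀ k, List (PStk k)) :
    TM2.stepAux (branch p q q') v T = TM2.stepAux q' v T := by
  rw [TM2.stepAux, h, cond_false]

theorem stepAux_push_main (f : Option Γ' → Γ') :
    TM2.stepAux (push (Sum.inr K'.main) f q) v (joinStk B (K'.elim m r [] [])) =
      TM2.stepAux q v (joinStk B (K'.elim (f v :: m) r [] [])) :=
  congrArg (TM2.stepAux q v)
    ((joinStk_update_inr B _ _ _).trans (congrArg (joinStk B) K'.elim_update_main))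

theorem stepAux_push_rev (f : Option Γ' → Γ') :
    TM2.stepAux (push (Sum.inr K'.rev) f q) v (joinStk B (K'.elim m r [] [])) =
      TM2.stepAux q v (joinStk B (K'.elim m (f v :: r) [] [])) :=
  congrArg (TM2.stepAux q v)
    ((joinStk_update_inr B _ _ _).trans (congrArg (joinStk B) K'.elim_update_rev))

theorem stepAux_pop_main (f : Option Γ' → Option Γ' → Option Γ') :
    TM2.stepAux (pop (Sum.inr K'.main) f q) v (joinStk B (K'.elim m r [] [])) =
      TM2.stepAux q (f v m.head?) (joinStk B (K'.elim m.tail r [] [])) :=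
  congrArg (TM2.stepAux q _)
    ((joinStk_update_inr B _ _ _).trans (congrArg (joinStk B) K'.elim_update_main))

theorem stepAux_pop_rev (f : Option Γ' → Option Γ' → Option Γ') :
    TM2.stepAux (pop (Sum.inr K'.rev) f q) v (joinStk B (K'.elim m r [] [])) =
      TM2.stepAux q (f v r.head?) (joinStk B (K'.elim m r.tail [] [])) :=
  congrArg (TM2.stepAux q _)
    ((joinStk_update_inr B _ _ _).trans (congrArg (joinStk B) K'.elim_update_rev))

end

/-- Configurations of the search machine in which only two work stacks are in use. -/
def scfg (c : Code) (l : SLab c) (v : Option Γ') (B : Fin 3 → List Bool) (m r : List Γ') :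
    (searchTM c).Cfg :=
  ⟨some l, v, joinStk B (K'.elim m r [] [])⟩

variable (v : Option Γ') (c : Code) (φ : StrFun) (B : Fin 3 → List Bool) (m r : List Γ')

theorem step_searchTM {l : SLab c} (hl : l ≠ Sum.inr Ctl.ask) (T : ∀ k, List (PStk k)) :
    (searchTM c).step φ ⟨some l, v, T⟩ = TM2.stepAux (searchProg c l) v T :=
  if_neg hl

theorem step_ask :
    (searchTM c).step φ (scfg c (Sum.inr Ctl.ask) v B m r) =
      scfg c (Sum.inr Ctl.resume) v (Function.update B 2 (φ (B 2))) m r := by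
  refine (if_pos rfl).trans ?_
  exact congrArg (fun T => (⟨some (Sum.inr Ctl.resume), v, T⟩ : (searchTM c).Cfg))
    (joinStk_update_inl B _ 2 _)

theorem step_start :
    (searchTM c).step φ (scfg c (Sum.inr Ctl.start) v B [] []) =
      liftCfg (slab c) (Sum.inr Ctl.flag) B (init c [1]) :=
  (step_searchTM v c φ (by simp) _).trans
    ((stepAux_push_main ..).trans (stepAux_push_main ..))

/-- The answer becomes the new lowest digit of the number left on the work stack. Zero is excluded
because its numeral is empty and a digit 0 put on top would not be a numeral. -/
theorem step_resume (b : Bool) (hB : B 2 = [b]) (n : ℕ) (hn : n ≠ 0) :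
    (searchTM c).step φ (scfg c (Sum.inr Ctl.resume) v B (trList [n]) []) =
      liftCfg (slab c) (Sum.inr Ctl.flag) (Function.update B 2 []) (init c [2 * n + b.toNat]) := by
  refine (step_searchTM v c φ (by simp) _).trans
    ((stepAux_pop_inl ..).trans ((stepAux_push_main ..).trans ?_))
  have e : trList [2 * n + b.toNat] = bitG b :: trList [n] := by simp [trNat_bit b n hn]
  rw [hB, init, e]
  rfl

theorem step_flag (a : Γ') :
    (searchTM c).step φ (scfg c (Sum.inr Ctl.flag) v B (a :: m) r) =
      scfg c (Sum.inr (Ctl.rd (decide (a = Γ'.bit1)))) (some a) B m r := by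
  refine (step_searchTM v c φ (by simp) _).trans ((stepAux_pop_main ..).trans ?_)
  cases a <;> rfl

theorem isDigit_bitG (x : Bool) : isDigit (some (bitG x)) = true := by cases x <;> rfl

theorem step_rd_digit (b : Bool) (x : Bool) :
    (searchTM c).step φ (scfg c (Sum.inr (Ctl.rd b)) v B (bitG x :: m) r) =
      scfg c (Sum.inr (Ctl.rd b)) (some (bitG x)) B m (bitG x :: r) := by
  refine (step_searchTM v c φ (by simp) _).trans ((stepAux_pop_main ..).trans
    ((stepAux_branch_true (isDigit_bitG x) ..).trans (stepAux_push_rev ..)))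

theorem step_rd_cons (b : Bool) :
    (searchTM c).step φ (scfg c (Sum.inr (Ctl.rd b)) v B (Γ'.cons :: m) r) =
      scfg c (Sum.inr (Ctl.wr b)) r.head? B m r.tail :=
  (step_searchTM v c φ (by simp) _).trans ((stepAux_pop_main ..).trans
    ((stepAux_branch_false rfl ..).trans (stepAux_pop_rev ..)))

theorem step_wr_digit (b : Bool) (x : Bool) :
    (searchTM c).step φ (scfg c (Sum.inr (Ctl.wr b)) v B m (bitG x :: r)) =
      scfg c (Sum.inr (Ctl.wr b)) (some (bitG x))
        (Function.update B (if b then 1 else 2) (x :: B (if b then 1 else 2))) m r := by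
  refine (step_searchTM v c φ (by simp) _).trans ((stepAux_pop_rev ..).trans ?_)
  cases x <;> exact (stepAux_branch_true rfl ..).trans (stepAux_push_inl ..)

theorem step_wr_query :
    (searchTM c).step φ (scfg c (Sum.inr (Ctl.wr false)) v B m []) =
      scfg c (Sum.inr Ctl.ask) none B m [] :=
  (step_searchTM v c φ (by simp) _).trans (stepAux_pop_rev ..)

theorem step_wr_output :
    (searchTM c).step φ (scfg c (Sum.inr (Ctl.wr true)) v B m []) =
      ⟨none, none, joinStk B (K'.elim m [] [] [])⟩ :=
  (step_searchTM v c φ (by simp) _).trans (stepAux_pop_rev ..)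

/-- Moving the digits to the auxiliary stack reverses them, so that the leading 1 ends on top; the
`tail` is its removal. -/
theorem reach_rd (b : Bool) (w : Word) :
    ∃ v', (searchTM c).Reach φ
      (scfg c (Sum.inr (Ctl.rd b)) v B (w.map bitG ++ Γ'.cons :: m) r)
      (scfg c (Sum.inr (Ctl.wr b)) v' B m ((w.map bitG).reverse ++ r).tail) := by
  induction w generalizing v r with
  | nil => exact ⟨_, .head (step_rd_cons ..) (.refl _)⟩
  | cons x w ih =>
    obtain ⟨v', h⟩ := ih (some (bitG x)) (bitG x :: r)
    refine ⟨v', .head (step_rd_digit ..) ?_⟩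
    simpa using h

/-- The second reversal, which restores the order of the letters on the query or output stack. -/
theorem reach_wr (b : Bool) (w : Word) :
    ∃ v', (searchTM c).Reach φ
      (scfg c (Sum.inr (Ctl.wr b)) v B m (w.map bitG))
      (scfg c (Sum.inr (Ctl.wr b)) v'
        (Function.update B (if b then 1 else 2) (w.reverse ++ B (if b then 1 else 2))) m []) := by
  induction w generalizing v B with
  | nil => exact ⟨v, by simpa using .refl _⟩
  | cons x w ih =>
    obtain ⟨v', h⟩ := ih (some (bitG x))
      (Function.update B (if b then 1 else 2) (x :: B (if b then 1 else 2)))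
    refine ⟨v', .head (step_wr_digit ..) ?_⟩
    simpa using h

theorem slab_eq {l : Λ'} (h : l ∈ codeLabels c) : slab c l = Sum.inl ⟨l, h⟩ := dif_pos h

/-- The search machine simulates the evaluation of its code. -/
theorem reach_eval {x y : List ℕ} (h : y ∈ Code.eval c x) :
    (searchTM c).Reach φ (liftCfg (slab c) (Sum.inr Ctl.flag) B (init c x))
      (scfg c (Sum.inr Ctl.flag) none B (trList y) []) := by
  have h1 : halt y ∈ StateTransition.eval (TM2.step tr) (init c x) := by
    rw [tr_eval]
    exact Part.mem_map _ h
  have h2 := (StateTransition.mem_eval.1 h1).1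
  have key : ∀ {e e' : Cfg'}, StateTransition.Reaches (TM2.step tr) e e' →
      e.l ∈ Finset.insertNone (codeLabels c) →
      (searchTM c).Reach φ (liftCfg (slab c) (Sum.inr Ctl.flag) B e)
        (liftCfg (slab c) (Sum.inr Ctl.flag) B e') := by
    intro e e' hr
    induction hr using Relation.ReflTransGen.head_induction_on with
    | refl => exact fun _ => .refl _
    | @head a b hab _ ih =>
      intro ha
      -- The evaluation stays within the finitely many supported labels, so the default value of
      -- `slab` is never used.
      have hb := @TM2.step_supports _ _ _ _ ⟨trNormal c Cont'.halt⟩ _ tr _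
        (tr_supports c Cont'.halt) _ _ hab ha
      refine .head ?_ (ih hb)
      obtain ⟨_ | l, u, T⟩ := a
      · exact absurd hab (by exact Option.not_mem_none _)
      · have hl : l ∈ codeLabels c := by simpa using ha
        have hb' : TM2.stepAux (tr l) u T = b := Option.some_inj.1 hab
        subst hb'
        have e1 : liftCfg (slab c) (Sum.inr Ctl.flag) B ⟨some l, u, T⟩ =
            ⟨some (Sum.inl ⟨l, hl⟩), u, joinStk B T⟩ := by
          rw [liftCfg, Option.elim_some, slab_eq c hl]
        exact (congrArg ((searchTM c).step φ) e1).trans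
          ((step_searchTM u c φ (by simp) _).trans (stepAux_liftStmt ..))
  refine key h2 ?_
  exact Finset.some_mem_insertNone.2 (codeSupp_self _ _ (trStmts₁_self _))

/-- One round of the search machine, up to the next query or the output. -/
theorem reach_round {x w n : ℕ} {b : Bool}
    (h : [2 * (w + 1) + b.toNat, n] ∈ Code.eval c [x]) (hB : B (if b then 1 else 2) = []) :
    ∃ v', (searchTM c).Reach φ (liftCfg (slab c) (Sum.inr Ctl.flag) B (init c [x]))
      (scfg c (Sum.inr (Ctl.wr b)) v'
        (Function.update B (if b then 1 else 2) (natToWord w)) (trList [n]) []) := by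
  -- The lowest digit is the flag that selects query or output; the digits above it spell the word,
  -- closed by the leading 1.
  have e : trList [2 * (w + 1) + b.toNat, n] =
      bitG b :: ((natToWord w ++ [true]).map bitG ++ Γ'.cons :: trList [n]) := by
    rw [trList, trNat_bit b _ (Nat.succ_ne_zero w), trNat_succ_eq]
    simp [bitG]
  have h1 := reach_eval c φ B h
  rw [e] at h1
  have hb : decide (bitG b = Γ'.bit1) = b := by cases b <;> simp [bitG]
  obtain ⟨v', h2⟩ := reach_rd (some (bitG b)) c φ B (trList [n]) [] b (natToWord w ++ [true])
  obtain ⟨v'', h3⟩ := reach_wr v' c φ B (trList [n]) b (natToWord w).reverse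
  refine ⟨v'', h1.trans (.head (step_flag ..) ?_)⟩
  rw [hb]
  refine h2.trans ?_
  simpa [hB] using h3

end SearchRun

/-- Functions on the natural numbers are evaluated, two at a time, by a code. -/
theorem exists_code_pair {f g : ℕ → ℕ} (hf : Primrec f) (hg : Primrec g) :
    ∃ c : Code, ∀ x, [f x, g x] ∈ Code.eval c [x] := by
  have key : ∀ {f : ℕ → ℕ}, Primrec f → ∃ c : Code, ∀ x, c.eval [x] = pure [f x] := by
    intro f hf
    have h1 : Nat.Partrec' (fun v : List.Vector ℕ 1 => (f v.head : Part ℕ)) :=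
      Nat.Partrec'.part_iff₁.2 (Primrec.to_comp hf).partrec
    obtain ⟨c, hc⟩ := Code.exists_code h1
    exact ⟨c, fun x => (hc ⟨[x], rfl⟩).trans (Part.map_some _ _)⟩
  obtain ⟨cf, hcf⟩ := key hf
  obtain ⟨cg, hcg⟩ := key hg
  exact ⟨Code.cons cf (Code.cons cg Code.nil), fun x => by simp [hcf, hcg]⟩

/-- There is an oracle machine that iterates a primitive recursive function on a natural number to
which the answer to a query is appended in each round. -/
theorem exists_iterating_machine {q nx : ℕ → ℕ} {h : ℕ → Bool} (hq : Primrec q) (hnx : Primrec nx)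
    (hh : Primrec h) (hpos : ∀ x, nx x ≠ 0) :
    ∃ M : OracleTM, ∀ (φ : StrFun) (x : ℕ → ℕ) (bit : ℕ → Bool) (T : ℕ), x 0 = 1 →
      (∀ n < T, h (x n) = false ∧ φ (natToWord (q (x n))) = [bit n] ∧
        x (n + 1) = 2 * nx (x n) + (bit n).toNat) →
      h (x T) = true → ∀ s, M.Outputs φ s (natToWord (q (x T))) := by
  -- The first result packs the flag `h x` and the word of `q x`; the second one is the state that
  -- is kept during the query.
  obtain ⟨c, hc⟩ := exists_code_pair
    (f := fun x => 2 * (q x + 1) + (h x).toNat) (g := nx)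
    (Primrec.nat_add.comp (Primrec.nat_mul.comp (Primrec.const 2) (Primrec.succ.comp hq))
      ((Primrec.dom_bool Bool.toNat).comp hh)) hnx
  refine ⟨searchTM c, fun φ x bit T h0 hstep hT s => ?_⟩
  let B : Fin 3 → List Bool := Function.update (fun _ => []) 0 s
  have hinit : (searchTM c).init s = scfg c (Sum.inr Ctl.start) none B [] [] := by
    have e : (fun k => ([] : List (PStk k))) = joinStk (fun _ => []) (K'.elim [] [] [] []) := by
      funext k
      rcases k with k | k
      · rfl
      · cases k <;> rfl
    have e2 : Function.update (fun k => ([] : List (PStk k))) (Sum.inl 0) (s : List Bool) =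
        joinStk B (K'.elim [] [] [] []) := by
      rw [e]
      exact joinStk_update_inl _ _ _ _
    exact congrArg (fun S => (⟨some (Sum.inr Ctl.start), none, S⟩ : (searchTM c).Cfg)) e2
  have key : ∀ n ≤ T, (searchTM c).Reach φ ((searchTM c).init s)
      (liftCfg (slab c) (Sum.inr Ctl.flag) B (init c [x n])) := by
    intro n
    induction n with
    | zero =>
      intro _
      rw [hinit, h0]
      exact .head (step_start ..) (.refl _)
    | succ n ih =>
      intro hn
      obtain ⟨a1, a2, a3⟩ := hstep n (by omega)
      have hcn := hc (x n)
      simp only [a1] at hcn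
      obtain ⟨v', hr⟩ := reach_round c φ B (b := false) hcn (by simp [B])
      refine (ih (by omega)).trans (hr.trans (.head (step_wr_query ..) (.head (step_ask ..) ?_)))
      simp only [Bool.false_eq_true, if_false, Function.update_self, Function.update_idem, a2]
      refine .head (step_resume (b := bit n) (hB := by simp) (hn := hpos _) ..) ?_
      have e : Function.update (Function.update B 2 [bit n]) 2 [] = B := by
        rw [Function.update_idem]
        exact Function.update_eq_self_iff.2 (by simp [B])
      rw [e, a3]
      exact .refl _
  have hcT := hc (x T)
  simp only [hT] at hcT
  obtain ⟨v', hr⟩ := reach_round c φ B (b := true) hcT (by simp [B])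
  obtain ⟨t, ht⟩ := ((key T le_rfl).trans hr).trans (.head (step_wr_output ..) (.refl _))
  refine ⟨t, ?_⟩
  rw [OracleTM.OutputsWithin, ht]
  refine ⟨rfl, ?_⟩
  change Function.update B 1 (natToWord (q (x T))) 1 = _
  simp

end SetRep

namespace SetRep

/-! ### Arithmetic of codes -/

theorem wordToNat_natToWord (n : ℕ) : wordToNat (natToWord n) = n := by
  induction n using Nat.strong_induction_on with
  | _ n ih =>
    rcases n with _ | n
    · rw [natToWord]; rfl
    · rw [natToWord_succ, wordToNat, ih _ (by omega)]
      rcases Nat.mod_two_eq_zero_or_one n with h | h <;> simp [h] <;> omega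

theorem natToWord_wordToNat (w : Word) : natToWord (wordToNat w) = w := by
  induction w with
  | nil => rw [wordToNat, natToWord]
  | cons b w ih =>
    cases b
    · have : wordToNat (false :: w) = 2 * wordToNat w + 1 := rfl
      rw [this, natToWord_succ]
      simp [ih]
    · have : wordToNat (true :: w) = 2 * wordToNat w + 1 + 1 := rfl
      rw [this, natToWord_succ, show (2 * wordToNat w + 1) / 2 = wordToNat w by omega, ih]
      congr 1
      simp

theorem natToWord_injective : Function.Injective natToWord :=
  Function.LeftInverse.injective wordToNat_natToWord

/-- All digits are 1, so the value is a geometric sum. Unary codes are thereby primitive recursive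
functions of their lengths. -/
theorem wordToNat_replicate (n : ℕ) : wordToNat (List.replicate n false) = 2 ^ n - 1 := by
  induction n with
  | zero => rfl
  | succ n ih =>
    rw [List.replicate_succ, wordToNat, ih, pow_succ]
    have := Nat.one_le_two_pow (n := n)
    simp; omega

theorem replicate_eq_natToWord (n : ℕ) : List.replicate n false = natToWord (2 ^ n - 1) := by
  rw [← wordToNat_replicate, natToWord_wordToNat]

theorem intCode_natCast (n : ℕ) : intCode n = 2 * n := rfl

theorem intCode_negSucc (n : ℕ) : intCode (Int.negSucc n) = 2 * n + 1 := rfl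

theorem intCode_neg_natCast {n : ℕ} (hn : n ≠ 0) : intCode (-(n : ℤ)) = 2 * n - 1 := by
  obtain ⟨m, rfl⟩ := Nat.exists_eq_succ_of_ne_zero hn
  have : (-((m.succ : ℕ) : ℤ)) = Int.negSucc m := rfl
  rw [this, intCode_negSucc]; omega

theorem intCode_injective : Function.Injective intCode := Equiv.intEquivNat.injective

theorem natAbs_le_intCode (k : ℤ) : k.natAbs ≤ intCode k := by
  rcases k with n | n
  · change n ≤ 2 * n; omega
  · change n + 1 ≤ 2 * n + 1; omega

/-- The values on the diagonal with sum `n` lie between consecutive triangular numbers, so the value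
determines the diagonal and then the offset. -/
theorem cantorPair_injective {a b a' b' : ℕ} (h : cantorPair a b = cantorPair a' b') :
    a = a' ∧ b = b' := by
  have tri : ∀ n, (n + 1) * (n + 1 + 1) / 2 = n * (n + 1) / 2 + (n + 1) := by
    intro n
    have : (n + 1) * (n + 1 + 1) = n * (n + 1) + (n + 1) * 2 := by ring
    rw [this, Nat.add_mul_div_right _ _ two_pos]
  have mono : Monotone fun n : ℕ => n * (n + 1) / 2 :=
    monotone_nat_of_le_succ fun n => by simp only [tri]; omega
  have key : a + b = a' + b' := by
    unfold cantorPair at h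
    rcases lt_trichotomy (a + b) (a' + b') with hl | hl | hl
    · have h1 := mono (Nat.succ_le_of_lt hl)
      simp only [Nat.succ_eq_add_one, tri] at h1
      omega
    · exact hl
    · have h1 := mono (Nat.succ_le_of_lt hl)
      simp only [Nat.succ_eq_add_one, tri] at h1
      omega
  unfold cantorPair at h
  rw [key] at h
  omega

theorem wordPair_injective {s t s' t' : Word} (h : wordPair s t = wordPair s' t') :
    s = s' ∧ t = t' := by
  have h1 := cantorPair_injective (natToWord_injective h)
  have inj : Function.Injective wordToNat :=
    Function.LeftInverse.injective natToWord_wordToNat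
  exact ⟨inj h1.1, inj h1.2⟩

theorem replicate_injective {m n : ℕ} (h : List.replicate m false = List.replicate n false) :
    m = n := by
  simpa using congrArg List.length h

theorem unInt_injective : Function.Injective unInt := fun _ _ h =>
  intCode_injective (replicate_injective h)

theorem dyCode_injective : Function.Injective dyCode := by
  rintro ⟨a, m⟩ ⟨b, n⟩ h
  obtain ⟨h1, h2⟩ := wordPair_injective h
  exact Prod.ext (intCode_injective (natToWord_injective h1)) (replicate_injective h2)

/-- Equal lengths are essential: the lists of pairs `(0, 0)` of all lengths have the empty word as
their code. -/
theorem dyListCode_injective {l l' : List (ℤ × ℕ)} (hl : l.length = l'.length)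
    (h : dyListCode l = dyListCode l') : l = l' := by
  induction l generalizing l' with
  | nil => exact (List.length_eq_zero_iff.1 hl.symm).symm
  | cons p l ih =>
    rcases l' with _ | ⟨p', l'⟩
    · simp at hl
    · rcases l with _ | ⟨q, l⟩ <;> rcases l' with _ | ⟨q', l'⟩
      · rw [dyCode_injective h]
      · simp at hl
      · simp at hl
      · obtain ⟨h1, h2⟩ := wordPair_injective h
        rw [dyCode_injective h1, ih (by simpa using hl) h2]

theorem ptCode_injective {d : ℕ} : Function.Injective (ptCode (d := d)) := fun _ _ h =>
  List.ofFn_injective (dyListCode_injective (by simp) h)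

theorem queryCode_injective {d : ℕ} {p p' : Fin d → ℤ × ℕ} {n n' : ℤ}
    (h : queryCode p n = queryCode p' n') : p = p' ∧ n = n' :=
  have h1 := wordPair_injective h
  ⟨ptCode_injective h1.1, unInt_injective h1.2⟩

theorem length_unInt (k : ℤ) : (unInt k).length = intCode k := List.length_replicate

/-- The number coded by a nonempty tuple of numbers. -/
def listNum : List ℕ → ℕ
  | [] => 0
  | [a] => a
  | a :: b :: l => cantorPair a (listNum (b :: l))

/-- The number of the code of a dyadic rational. -/
def dyNum (p : ℤ × ℕ) : ℕ := cantorPair (intCode p.1) (2 ^ p.2 - 1)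

theorem dyCode_eq (p : ℤ × ℕ) : dyCode p = natToWord (dyNum p) := by
  rw [dyCode, wordPair, binInt, wordToNat_natToWord, wordToNat_replicate, dyNum]

theorem dyListCode_eq (l : List (ℤ × ℕ)) : dyListCode l = natToWord (listNum (l.map dyNum)) := by
  induction l with
  | nil => rw [dyListCode, List.map_nil, listNum, natToWord]
  | cons p l ih =>
    rcases l with _ | ⟨q, l⟩
    · exact dyCode_eq p
    · rw [dyListCode, ih, dyCode_eq, wordPair, wordToNat_natToWord, wordToNat_natToWord]
      rfl

theorem ptCode_eq {d : ℕ} (p : Fin d → ℤ × ℕ) :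
    ptCode p = natToWord (listNum (List.ofFn fun i => dyNum (p i))) := by
  rw [ptCode, dyListCode_eq, List.map_ofFn]; rfl

theorem unInt_eq (k : ℤ) : unInt k = natToWord (2 ^ intCode k - 1) := replicate_eq_natToWord _

theorem queryCode_eq {d : ℕ} (p : Fin d → ℤ × ℕ) (n : ℤ) : queryCode p n =
    natToWord (cantorPair (listNum (List.ofFn fun i => dyNum (p i))) (2 ^ intCode n - 1)) := by
  rw [queryCode, wordPair, ptCode_eq, unInt_eq, wordToNat_natToWord, wordToNat_natToWord]

/-! ### Primitive recursive codes -/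

theorem primrec_cantorPair {f g : ℕ → ℕ} (hf : Primrec f) (hg : Primrec g) :
    Primrec fun i => cantorPair (f i) (g i) := by
  have hs : Primrec fun i => f i + g i := Primrec.nat_add.comp hf hg
  exact Primrec.nat_add.comp (Primrec.nat_div.comp
    (Primrec.nat_mul.comp hs (Primrec.succ.comp hs)) (Primrec.const 2)) hg

theorem primrec_two_pow {f : ℕ → ℕ} (hf : Primrec f) : Primrec fun i => 2 ^ f i := by
  have h : Primrec fun n : ℕ => 2 ^ n := by
    refine (Primrec.nat_rec₁ 1 (f := fun _ k => 2 * k)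
      (Primrec.nat_mul.comp (Primrec.const 2) Primrec.snd)).of_eq fun n => ?_
    induction n with
    | zero => rfl
    | succ n ih => rw [pow_succ, mul_comm, ← ih]
  exact h.comp hf

theorem primrec_mersenne {f : ℕ → ℕ} (hf : Primrec f) : Primrec fun i => 2 ^ f i - 1 :=
  Primrec.nat_sub.comp (primrec_two_pow hf) (Primrec.const 1)

theorem primrec_listNum {d : ℕ} {f : Fin d → ℕ → ℕ} (hf : ∀ j, Primrec (f j)) :
    Primrec fun i => listNum (List.ofFn fun j => f j i) := by
  induction d with
  | zero => exact (Primrec.const 0).of_eq fun _ => by simp [listNum]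
  | succ d ih =>
    rcases d with _ | d
    · exact (hf 0).of_eq fun _ => by simp [listNum]
    · refine (primrec_cantorPair (hf 0) (ih fun j => hf j.succ)).of_eq fun _ => ?_
      simp [List.ofFn_succ, listNum]

theorem primrec_queryNum {d : ℕ} {p : ℕ → Fin d → ℤ × ℕ} {n : ℕ → ℤ}
    (h1 : ∀ j, Primrec fun i => intCode (p i j).1) (h2 : ∀ j, Primrec fun i => (p i j).2)
    (hn : Primrec fun i => intCode (n i)) :
    ∃ f : ℕ → ℕ, Primrec f ∧ ∀ i, queryCode (p i) (n i) = natToWord (f i) :=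
  ⟨_, primrec_cantorPair (primrec_listNum (f := fun j i => dyNum (p i j)) fun j =>
    primrec_cantorPair (h1 j) (primrec_mersenne (h2 j))) (primrec_mersenne hn),
    fun _ => queryCode_eq _ _⟩

theorem primrec_ptNum {d : ℕ} {p : ℕ → Fin d → ℤ × ℕ}
    (h1 : ∀ j, Primrec fun i => intCode (p i j).1) (h2 : ∀ j, Primrec fun i => (p i j).2) :
    ∃ f : ℕ → ℕ, Primrec f ∧ ∀ i, ptCode (p i) = natToWord (f i) :=
  ⟨_, primrec_listNum (f := fun j i => dyNum (p i j)) fun j =>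
    primrec_cantorPair (h1 j) (primrec_mersenne (h2 j)), fun _ => ptCode_eq _⟩

theorem primrec_intCode_sub {f g : ℕ → ℕ} (hf : Primrec f) (hg : Primrec g) :
    Primrec fun i => intCode ((f i : ℤ) - g i) := by
  refine (Primrec.ite (Primrec.nat_le.comp hg hf)
    (Primrec.nat_mul.comp (Primrec.const 2) (Primrec.nat_sub.comp hf hg))
    (Primrec.nat_sub.comp (Primrec.nat_mul.comp (Primrec.const 2) (Primrec.nat_sub.comp hg hf))
      (Primrec.const 1))).of_eq fun i => ?_
  split_ifs with h
  · rw [← Nat.cast_sub h, intCode_natCast]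
  · have e : ((f i : ℤ) - g i) = -((g i - f i : ℕ) : ℤ) := by omega
    rw [e, intCode_neg_natCast (by omega)]

/-! ### Search machines -/

/-- The function of a list of functions that is given by its position. -/
def tableFun : List (ℕ → ℕ) → ℕ → ℕ → ℕ
  | [], _, _ => 0
  | f :: _, 0, i => f i
  | _ :: L, j + 1, i => tableFun L j i

theorem primrec_tableFun {L : List (ℕ → ℕ)} (hL : ∀ f ∈ L, Primrec f) :
    Primrec₂ (tableFun L) := by
  induction L with
  | nil => exact Primrec.const 0
  | cons f L ih =>
    have h := Primrec.nat_casesOn (Primrec.fst (α := ℕ) (β := ℕ))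
      ((hL f (by simp)).comp Primrec.snd)
      (h := fun p j => tableFun L j p.2)
      ((ih fun g hg => hL g (by simp [hg])).comp Primrec.snd
        (Primrec.snd.comp Primrec.fst)).to₂
    refine h.of_eq fun ⟨j, i⟩ => ?_
    cases j <;> rfl

theorem tableFun_eq (L : List (ℕ → ℕ)) (j : ℕ) (hj : j < L.length) (i : ℕ) :
    tableFun L j i = L[j] i := by
  induction L generalizing j with
  | nil => simp at hj
  | cons f L ih =>
    cases j with
    | zero => rfl
    | succ j => simpa [tableFun] using ih j (by simpa using hj)

/-- There is a machine that searches for the first index at which a finite list of queries is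
answered as expected, and outputs a function of this index. -/
theorem exists_search_machine (L : List (ℕ → ℕ)) (e : List Bool) (G : ℕ → ℕ)
    (hL : ∀ f ∈ L, Primrec f) (hG : Primrec G) :
    ∃ M : OracleTM, ∀ φ : StrFun, (∀ s, φ s = [true] ∨ φ s = [false]) → ∀ i₀ : ℕ,
      (∀ j < L.length, φ (natToWord (tableFun L j i₀)) = [e.getD j false]) →
      (∀ i < i₀, ∃ j < L.length, φ (natToWord (tableFun L j i)) ≠ [e.getD j false]) →
      ∀ s, M.Outputs φ s (natToWord (G i₀)) := by
  -- the pair of a position in the list and an index, after the last answer has been evaluated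
  let cur : ℕ → ℕ × ℕ := fun x => if x / 2 = 0 then (0, 0) else
    if decide (x % 2 = 1) = e.getD (x / 2 - 1).unpair.1 false then
      ((x / 2 - 1).unpair.1 + 1, (x / 2 - 1).unpair.2) else (0, (x / 2 - 1).unpair.2 + 1)
  have hhalf : Primrec fun x : ℕ => x / 2 := Primrec.nat_div.comp .id (.const 2)
  have hmod : Primrec fun x : ℕ => x % 2 := Primrec.nat_mod.comp .id (.const 2)
  have hun : Primrec fun x : ℕ => (x / 2 - 1).unpair :=
    Primrec.unpair.comp (Primrec.nat_sub.comp hhalf (.const 1))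
  have hcur : Primrec cur := by
    refine Primrec.ite (Primrec.eq.comp hhalf (.const 0)) (.const _) (Primrec.ite
      (Primrec.eq.comp (Primrec.eq.comp hmod (.const 1)).decide
        ((Primrec.list_getD false).comp (.const e) (Primrec.fst.comp hun)))
      (Primrec.pair (Primrec.succ.comp (Primrec.fst.comp hun)) (Primrec.snd.comp hun))
      (Primrec.pair (.const 0) (Primrec.succ.comp (Primrec.snd.comp hun))))
  let h : ℕ → Bool := fun x => decide (L.length ≤ (cur x).1)
  have hh : Primrec h :=
    (Primrec.nat_le.comp (.const L.length) (Primrec.fst.comp hcur)).decide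
  let q : ℕ → ℕ := fun x => bif h x then G (cur x).2 else tableFun L (cur x).1 (cur x).2
  have hq : Primrec q := Primrec.cond hh (hG.comp (Primrec.snd.comp hcur))
    ((primrec_tableFun hL).comp (Primrec.fst.comp hcur) (Primrec.snd.comp hcur))
  -- The successor makes every later state have a nonzero half, which distinguishes it from the
  -- initial state 1.
  let nx : ℕ → ℕ := fun x => Nat.pair (cur x).1 (cur x).2 + 1
  have hnx : Primrec nx := Primrec.succ.comp
    (Primrec₂.natPair.comp (Primrec.fst.comp hcur) (Primrec.snd.comp hcur))
  obtain ⟨M, hM⟩ := exists_iterating_machine hq hnx hh fun x => Nat.succ_ne_zero _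
  refine ⟨M, fun φ hφ i₀ h1 h2 => ?_⟩
  let ans : ℕ → Bool := fun x => decide (φ (natToWord (q x)) = [true])
  have hans : ∀ x, φ (natToWord (q x)) = [ans x] := fun x => by
    rcases hφ (natToWord (q x)) with h | h <;> simp [ans, h]
  let x : ℕ → ℕ := fun n => Nat.rec 1 (fun _ y => 2 * nx y + (ans y).toNat) n
  have hx : ∀ n, x (n + 1) = 2 * nx (x n) + (ans (x n)).toNat := fun n => rfl
  have hcur0 : cur (x 0) = (0, 0) := if_pos (by norm_num [x])
  have hcurS : ∀ n, cur (x (n + 1)) = if ans (x n) = e.getD (cur (x n)).1 false then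
      ((cur (x n)).1 + 1, (cur (x n)).2) else (0, (cur (x n)).2 + 1) := by
    intro n
    have e1 : x (n + 1) / 2 = nx (x n) := by
      rw [hx]; have := Bool.toNat_lt (ans (x n)); omega
    have e2 : decide (x (n + 1) % 2 = 1) = ans (x n) := by
      rw [hx]; cases ans (x n) <;> simp
    have e3 : nx (x n) - 1 = Nat.pair (cur (x n)).1 (cur (x n)).2 := rfl
    change (if x (n + 1) / 2 = 0 then (0, 0) else _) = _
    rw [if_neg (by rw [e1]; exact Nat.succ_ne_zero _), e1, e2, e3, Nat.unpair_pair]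
  -- `A j i`: the run arrives at position `j` of the list for index `i` without having halted
  -- before.
  let A : ℕ → ℕ → Prop := fun j i =>
    ∃ n, cur (x n) = (j, i) ∧ ∀ m < n, (cur (x m)).1 < L.length
  have hstep : ∀ j i, A j i → j < L.length →
      if φ (natToWord (tableFun L j i)) = [e.getD j false] then A (j + 1) i else A 0 (i + 1) := by
    rintro j i ⟨n, hn, hm⟩ hj
    have hhn : h (x n) = false := by simp [h, hn, hj]
    have hqn : q (x n) = tableFun L j i := by simp only [q, hhn, cond_false, hn]
    have hS := hcurS n
    have hm' : ∀ m < n + 1, (cur (x m)).1 < L.length := by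
      intro m hlt
      rcases Nat.lt_succ_iff_lt_or_eq.1 hlt with h | rfl
      · exact hm m h
      · rw [hn]; exact hj
    rw [← hqn, hans]
    rw [hn] at hS
    split_ifs with hc
    · rw [if_pos (by simpa using hc)] at hS
      exact ⟨n + 1, hS, hm'⟩
    · rw [if_neg (by simpa using hc)] at hS
      exact ⟨n + 1, hS, hm'⟩
  have hrow : ∀ i, A 0 i → ∀ j ≤ L.length,
      (∀ k < j, φ (natToWord (tableFun L k i)) = [e.getD k false]) → A j i := by
    intro i h0 j
    induction j with
    | zero => exact fun _ _ => h0
    | succ j ih =>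
      intro hj hk
      have := hstep j i (ih (by omega) fun k hk' => hk k (by omega)) (by omega)
      rwa [if_pos (hk j (by omega))] at this
  have hstart : ∀ i ≤ i₀, A 0 i := by
    intro i
    induction i with
    | zero => exact fun _ => ⟨0, hcur0, by simp⟩
    | succ i ih =>
      intro hi
      classical
      have hex := h2 i (by omega)
      -- The run follows index `i` up to its first unexpected answer and then turns to `i + 1`.
      obtain ⟨hj, hne⟩ := Nat.find_spec hex
      have := hstep _ i (hrow i (ih (by omega)) _ hj.le fun k hk => by
        by_contra hc
        exact Nat.find_min hex hk ⟨by omega, hc⟩) hj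
      rwa [if_neg hne] at this
  obtain ⟨T, hT, hmin⟩ := hrow i₀ (hstart i₀ le_rfl) _ le_rfl h1
  have hhT : h (x T) = true := by simp [h, hT]
  have hqT : q (x T) = G i₀ := by simp only [q, hhT, cond_true, hT]
  intro s
  rw [← hqT]
  exact hM φ x (fun n => ans (x n)) T rfl
    (fun n hn => ⟨by simpa [h] using hmin n hn, hans _, hx n⟩) hhT s

end SetRep

namespace SetRep

/-! ### Bounds on runs of oracle machines -/

open Turing in
/-- An upper bound on the number of symbols which a program pushes in one step. -/
def pushCount {K : Type} {Γ : K → Type} {Λ σ : Type} : TM2.Stmt Γ Λ σ → ℕ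
  | .push _ _ q => pushCount q + 1
  | .peek _ _ q => pushCount q
  | .pop _ _ q => pushCount q
  | .load _ q => pushCount q
  | .branch _ q₁ q₂ => pushCount q₁ + pushCount q₂
  | .goto _ => 0
  | .halt => 0

open Turing in
theorem length_stepAux_le {K : Type} [DecidableEq K] {Γ : K → Type} {Λ σ : Type}
    (q : TM2.Stmt Γ Λ σ) (v : σ) (S : ∀ k, List (Γ k)) (k : K) :
    ((TM2.stepAux q v S).stk k).length ≤ (S k).length + pushCount q := by
  induction q generalizing v S with
  | push j f q ih =>
    refine (ih _ _).trans ?_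
    by_cases h : k = j
    · subst h; simp [pushCount]; omega
    · simp only [pushCount, Function.update_of_ne h]; omega
  | peek j f q ih => exact ih _ _
  | pop j f q ih =>
    refine (ih _ _).trans ?_
    by_cases h : k = j
    · subst h; simp [pushCount]
    · simp [pushCount, Function.update_of_ne h]
  | load f q ih => exact ih _ _
  | branch f q₁ q₂ ih₁ ih₂ =>
    rw [TM2.stepAux]
    cases f v
    · exact (ih₂ _ _).trans (by simp [pushCount])
    · exact (ih₁ _ _).trans (by simp [pushCount])
  | goto f => exact le_rfl
  | halt => exact le_rfl

namespace OracleTM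

/-- There are finitely many programs, so the pushes per step are bounded. A query may write a long
answer in one step, but only on the query stack. -/
theorem exists_output_bound (M : OracleTM) :
    ∃ C : ℕ, ∀ φ s w t, M.OutputsWithin φ s w t → w.length ≤ C * t := by
  obtain ⟨C, hC⟩ := (Set.finite_range fun l => pushCount (M.prog l)).bddAbove
  refine ⟨C, fun φ s w t h => ?_⟩
  have key : ∀ t, (((M.step φ)^[t] (M.init s)).stk (Sum.inl 1)).length ≤ C * t := by
    intro t
    induction t with
    | zero => exact Nat.le_of_eq rfl
    | succ t ih =>
      rw [Function.iterate_succ_apply']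
      generalize (M.step φ)^[t] (M.init s) = c at ih
      refine le_trans ?_ (Nat.add_le_add_right ih C)
      unfold OracleTM.step
      split
      · exact Nat.le_add_right _ _
      · rename_i l _
        split_ifs
        · refine le_trans (le_of_eq ?_) (Nat.le_add_right _ _)
          have hne : (Sum.inl 1 : Fin 3 ⊕ M.K) ≠ Sum.inl 2 := by simp
          exact congrArg List.length 
            (Function.update_of_ne hne (φ (c.stk (Sum.inl 2)) : List Bool) c.stk)
        · exact (length_stepAux_le _ _ _ _).trans
            (Nat.add_le_add_left (hC (Set.mem_range_self l)) _)
  rw [← h.2]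
  exact key t

theorem step_congr (M : OracleTM) {φ ψ : StrFun} (c : M.Cfg)
    (h : ψ (c.stk (Sum.inl 2)) = φ (c.stk (Sum.inl 2))) : M.step ψ c = M.step φ c := by
  unfold OracleTM.step
  rw [h]

/-- A run of `t` steps asks at most `t` queries. -/
theorem exists_queries (M : OracleTM) (φ : StrFun) (s : Word) (t : ℕ) :
    ∃ Q : Finset Word, Q.card ≤ t ∧ ∀ ψ : StrFun, (∀ u ∈ Q, ψ u = φ u) →
      (M.step ψ)^[t] (M.init s) = (M.step φ)^[t] (M.init s) := by
  classical
  induction t with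
  | zero => exact ⟨∅, le_rfl, fun _ _ => rfl⟩
  | succ t ih =>
    obtain ⟨Q, hQ, h⟩ := ih
    -- The content of the query stack is recorded at every step, whether or not it is asked; the run
    -- depends on no other values.
    refine ⟨insert (((M.step φ)^[t] (M.init s)).stk (Sum.inl 2) : List Bool) Q,
      (Finset.card_insert_le _ _).trans (Nat.succ_le_succ hQ), fun ψ hψ => ?_⟩
    rw [Function.iterate_succ_apply', Function.iterate_succ_apply',
      h ψ fun u hu => hψ u (Finset.mem_insert_of_mem hu)]
    exact M.step_congr _ (hψ _ (Finset.mem_insert_self _ _))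

theorem step_of_halted (M : OracleTM) (φ : StrFun) {c : M.Cfg} (h : c.l = none) :
    M.step φ c = c := by
  unfold OracleTM.step
  rw [h]

theorem outputsWithin_unique {M : OracleTM} {φ : StrFun} {s w w' : Word} {t t' : ℕ}
    (h : M.OutputsWithin φ s w t) (h' : M.OutputsWithin φ s w' t') : w = w' := by
  wlog hle : t ≤ t' generalizing t t' w w'
  · exact (this h' h (by omega)).symm
  obtain ⟨k, rfl⟩ := Nat.exists_eq_add_of_le' hle
  have hfix : ∀ k, (M.step φ)^[k] ((M.step φ)^[t] (M.init s)) = (M.step φ)^[t] (M.init s) := by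
    intro k
    exact Function.iterate_fixed (M.step_of_halted φ h.1) k
  rw [← h.2, ← h'.2, Function.iterate_add_apply, hfix]

theorem outputs_unique {M : OracleTM} {φ : StrFun} {s w w' : Word}
    (h : M.Outputs φ s w) (h' : M.Outputs φ s w') : w = w' :=
  outputsWithin_unique h.choose_spec h'.choose_spec

end OracleTM

/-- What a polynomial-time machine does on the empty input. -/
theorem IsPolyTime.exists_run {X : Type} {ρ : Rep X} {E : X → Set Word}
    (h : IsPolyTime ρ wordRep E) :
    ∃ (M : OracleTM) (τ : Polynomial ℕ), ∀ φ x ℓ, ρ.IsName φ x ℓ → (E x).Nonempty →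
      ∃ w ∈ E x, M.OutputsWithin φ [] w (τ.eval ℓ) := by
  obtain ⟨g, M, τ, t, hg, hM⟩ := h
  refine ⟨M, τ * Polynomial.C (t.eval 0), fun φ x ℓ hx hE => ?_⟩
  obtain ⟨w, hw, ℓ', h1, -⟩ := hg φ x ℓ hx hE
  refine ⟨w, hw, ?_⟩
  have := hM φ ℓ ⟨x, hx, hE⟩ []
  rw [h1 []] at this
  simpa using this

/-- From names with advice of bounded length, only words of bounded length can be computed in
polynomial time. -/
theorem IsPolyTime.exists_length_le {X : Type} {ρ : Rep X} {E : X → Set Word}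
    (h : IsPolyTime ρ wordRep E) (ℓ : ℕ) :
    ∃ B : ℕ, ∀ φ x, ρ.IsName φ x ℓ → (E x).Nonempty → ∃ w ∈ E x, w.length ≤ B := by
  obtain ⟨M, τ, hM⟩ := h.exists_run
  obtain ⟨C, hC⟩ := M.exists_output_bound
  exact ⟨C * τ.eval ℓ, fun φ x hx hE =>
    let ⟨w, hw, h1⟩ := hM φ x ℓ hx hE
    ⟨w, hw, hC _ _ _ _ h1⟩⟩

/-- Because of the padding, both components of a pair are consulted at the tail of the query, even
when only the second one is asked for. -/
theorem strPair_congr {φ φ' : StrFun} (ψ : StrFun) {u : Word} (h : φ u.tail = φ' u.tail) :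
    strPair φ ψ u = strPair φ' ψ u := by
  rcases u with _ | ⟨_ | _, u⟩
  · rfl
  · simp only [strPair]; rw [show φ u = φ' u from h]
  · simp only [strPair]; rw [show φ u = φ' u from h]

theorem Rep.enrich_isName {X : Type} {ρ : Rep X} {E : X → Set Word} {φ : StrFun} {x : X} {ℓ : ℕ}
    {w : Word} (h : ρ.IsName φ x ℓ) (hw : w ∈ E x) :
    (ρ.enrich E).IsName (strPair φ fun _ => w) x (ℓ + w.length) :=
  ⟨φ, _, w, ℓ, rfl, h, ⟨fun _ => rfl, rfl⟩, hw, rfl⟩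

end SetRep

namespace SetRep

/-! ### Well-behaved norms -/

section Norm

variable {d : ℕ} {N : Seminorm ℝ (Fin d → ℝ)}

theorem exists_norm_upper_bound (N : Seminorm ℝ (Fin d → ℝ)) :
    ∃ C : ℝ, 0 < C ∧ ∀ x, N x ≤ C * ‖x‖ := by
  refine ⟨(∑ i, N (Pi.single i 1)) + 1, by positivity, fun x => ?_⟩
  have h1 : N x ≤ ∑ i, N (Pi.single i (x i)) := by
    conv_lhs => rw [← Finset.univ_sum_single x]
    exact Finset.le_sum_of_subadditive N (map_zero N).le (map_add_le_add N) _ _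
  refine h1.trans ?_
  have h2 : ∀ i, N (Pi.single i (x i)) ≤ N (Pi.single i 1) * ‖x‖ := by
    intro i
    have : (Pi.single i (x i) : Fin d → ℝ) = x i • Pi.single i 1 := by
      rw [← Pi.single_smul]; simp
    rw [this, map_smul_eq_mul, mul_comm]
    exact mul_le_mul_of_nonneg_left (norm_le_pi_norm x i) (apply_nonneg N _)
  refine (Finset.sum_le_sum fun i _ => h2 i).trans ?_
  rw [← Finset.sum_mul]
  exact mul_le_mul_of_nonneg_right (by linarith) (norm_nonneg x)

theorem continuous_seminorm (N : Seminorm ℝ (Fin d → ℝ)) : Continuous N := by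
  obtain ⟨C, hC, h⟩ := exists_norm_upper_bound N
  refine Seminorm.continuous_of_le (q := C.toNNReal • normSeminorm ℝ (Fin d → ℝ)) ?_ ?_
  · exact (continuous_norm (E := Fin d → ℝ)).const_smul C.toNNReal
  · intro x
    simpa [NNReal.smul_def, hC.le] using h x

/-- Equivalence with the maximum norm, by compactness of its unit sphere; the sphere is empty only
in dimension 0. -/
theorem exists_norm_bounds (hN : WellBehaved N) :
    ∃ c C : ℝ, 0 < c ∧ 0 < C ∧ ∀ x, c * ‖x‖ ≤ N x ∧ N x ≤ C * ‖x‖ := by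
  obtain ⟨C, hC, hup⟩ := exists_norm_upper_bound N
  have hcont := continuous_seminorm N
  suffices h : ∃ c : ℝ, 0 < c ∧ ∀ x, c * ‖x‖ ≤ N x by
    obtain ⟨c, hc, h⟩ := h
    exact ⟨c, C, hc, hC, fun x => ⟨h x, hup x⟩⟩
  rcases (Metric.sphere (0 : Fin d → ℝ) 1).eq_empty_or_nonempty with he | hne
  · refine ⟨1, one_pos, fun x => ?_⟩
    have : x = 0 := by
      by_contra hx
      have : (‖x‖⁻¹ • x) ∈ Metric.sphere (0 : Fin d → ℝ) 1 := by
        simp [norm_smul, norm_ne_zero_iff.2 hx]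
      simp [he] at this
    simp [this]
  · obtain ⟨y, hy, hmin⟩ := (isCompact_sphere (0 : Fin d → ℝ) 1).exists_isMinOn hne
      hcont.continuousOn
    have hy1 : ‖y‖ = 1 := by simpa using hy
    have hpos : 0 < N y := lt_of_le_of_ne (apply_nonneg N y) fun h => by
      have := hN.definite y h.symm
      simp [this] at hy1
    refine ⟨N y, hpos, fun x => ?_⟩
    rcases eq_or_ne x 0 with rfl | hx
    · simp
    have hx' : 0 < ‖x‖ := norm_pos_iff.2 hx
    have h1 : (‖x‖⁻¹ • x) ∈ Metric.sphere (0 : Fin d → ℝ) 1 := by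
      simp [norm_smul, hx'.ne']
    have h2 : N y ≤ N (‖x‖⁻¹ • x) := hmin h1
    rw [map_smul_eq_mul, norm_inv, norm_norm, inv_mul_eq_div, le_div_iff₀ hx'] at h2
    exact h2

theorem isClosed_closedBall (N : Seminorm ℝ (Fin d → ℝ)) (x : Fin d → ℝ) (r : ℝ) :
    IsClosed (N.closedBall x r) :=
  isClosed_le ((continuous_seminorm N).comp (continuous_id.sub continuous_const)) continuous_const

theorem isOpen_ball (N : Seminorm ℝ (Fin d → ℝ)) (x : Fin d → ℝ) (r : ℝ) : IsOpen (N.ball x r) :=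
  isOpen_lt ((continuous_seminorm N).comp (continuous_id.sub continuous_const)) continuous_const

theorem ball_subset_closedBall (x : Fin d → ℝ) (r : ℝ) : N.ball x r ⊆ N.closedBall x r :=
  fun _ hy => (show N (_ - x) < r from hy).le

theorem mem_interior_of_closedBall_subset {x : Fin d → ℝ} {r : ℝ}
    (hr : 0 < r) {S : Set (Fin d → ℝ)} (h : N.closedBall x r ⊆ S) : x ∈ interior S :=
  mem_interior.2 ⟨N.ball x r, (ball_subset_closedBall x r).trans h, isOpen_ball N x r, by
    simpa using hr⟩

theorem isCompact_closedBall (hN : WellBehaved N) (x : Fin d → ℝ) (r : ℝ) :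
    IsCompact (N.closedBall x r) := by
  obtain ⟨c, C, hc, -, h⟩ := exists_norm_bounds hN
  refine Metric.isCompact_of_isClosed_isBounded (isClosed_closedBall N x r) ?_
  refine (Metric.isBounded_closedBall (x := x) (r := r / c)).subset fun y hy => ?_
  rw [mem_closedBall_iff_norm, le_div_iff₀ hc, mul_comm]
  exact (h _).1.trans hy

theorem closedBall_mem_KCR (hN : WellBehaved N) (x : Fin d → ℝ) {r : ℝ} (hr : 0 < r) :
    N.closedBall x r ∈ KCR d := by
  have hconv : Convex ℝ (N.closedBall x r) := N.convex_closedBall x r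
  have hcl := isClosed_closedBall N x r
  refine ⟨⟨⟨⟨hcl, ⟨x, by simpa using hr.le⟩⟩, ?_⟩, isCompact_closedBall hN x r⟩, hconv⟩
  rw [hconv.closure_interior_eq_closure_of_nonempty_interior
    ⟨x, mem_interior_of_closedBall_subset hr subset_rfl⟩, hcl.closure_eq]

theorem union_mem_KR {S T : Set (Fin d → ℝ)} (hS : S ∈ KR d) (hT : T ∈ KR d) : S ∪ T ∈ KR d := by
  refine ⟨⟨⟨hS.1.1.1.union hT.1.1.1, hS.1.1.2.mono Set.subset_union_left⟩, ?_⟩, hS.2.union hT.2⟩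
  refine subset_antisymm ((closure_mono interior_subset).trans
    (hS.1.1.1.union hT.1.1.1).closure_eq.subset) (Set.union_subset ?_ ?_)
  · conv_lhs => rw [← hS.1.2]
    exact closure_mono (interior_mono Set.subset_union_left)
  · conv_lhs => rw [← hT.1.2]
    exact closure_mono (interior_mono Set.subset_union_right)

theorem exists_unit_vector (hd : 1 ≤ d) (hN : WellBehaved N) : ∃ v : Fin d → ℝ, N v = 1 := by
  let e : Fin d → ℝ := Pi.single ⟨0, hd⟩ 1
  have he : N e ≠ 0 := fun h => by
    have := congrFun (hN.definite _ h) ⟨0, hd⟩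
    simp [e] at this
  exact ⟨(N e)⁻¹ • e, by
    rw [map_smul_eq_mul, norm_inv, Real.norm_of_nonneg (apply_nonneg N e), inv_mul_cancel₀ he]⟩

theorem apply_sub_smul {v : Fin d → ℝ} (hv : N v = 1) (s t : ℝ) :
    N (s • v - t • v) = |s - t| := by
  rw [← sub_smul, map_smul_eq_mul, hv, mul_one, Real.norm_eq_abs]

theorem apply_smul {v : Fin d → ℝ} (hv : N v = 1) (s : ℝ) : N (s • v) = |s| := by
  rw [map_smul_eq_mul, hv, mul_one, Real.norm_eq_abs]

/-- An inclusion between balls implies the inequality between the radii. -/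
theorem radius_le_of_subset (hd : 1 ≤ d) (hN : WellBehaved N) {x y : Fin d → ℝ} {r s : ℝ}
    (hr : 0 ≤ r) (h : N.closedBall x r ⊆ N.closedBall y s) : r ≤ s := by
  obtain ⟨v, hv⟩ := exists_unit_vector hd hN
  -- The two ends of a diameter of the inner ball have distance `2 * r`, and both lie within `s` of
  -- `y`.
  have h1 : N (x + r • v - y) ≤ s := h (by
    simp [Seminorm.mem_closedBall, map_smul_eq_mul, hv, abs_of_nonneg hr])
  have h2 : N (x - r • v - y) ≤ s := h (by
    simp [Seminorm.mem_closedBall, sub_eq_add_neg, map_smul_eq_mul, hv, abs_of_nonneg hr])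
  have h3 : N ((x + r • v - y) - (x - r • v - y)) ≤ s + s := (map_sub_le_add N _ _).trans
    (by linarith)
  have h4 : (x + r • v - y) - (x - r • v - y) = (2 * r) • v := by
    rw [mul_smul, two_smul]; abel
  rw [h4, apply_smul hv, abs_of_nonneg (by linarith)] at h3
  linarith

theorem exists_dyadic_point_ge (hd : 1 ≤ d) (hN : WellBehaved N) (R : ℝ) :
    ∃ p : Fin d → ℤ × ℕ, R ≤ N (ptVal p) := by
  obtain ⟨c, _, hc, _, h⟩ := exists_norm_bounds hN
  obtain ⟨k, hk⟩ := exists_nat_ge (R / c)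
  refine ⟨fun _ => (k, 0), le_trans ?_ (h _).1⟩
  rw [div_le_iff₀ hc, mul_comm] at hk
  refine hk.trans (mul_le_mul_of_nonneg_left ?_ hc.le)
  have := norm_le_pi_norm (ptVal fun _ : Fin d => ((k : ℤ), 0)) ⟨0, hd⟩
  simpa [ptVal, dyVal] using this

theorem ptVal_zero : ptVal (fun _ : Fin d => ((0 : ℤ), 0)) = 0 := by
  funext i; simp [ptVal, dyVal]

end Norm

end SetRep

namespace SetRep

/-! ### Canonical names -/

section Names

variable {d : ℕ} (N : Seminorm ℝ (Fin d → ℝ)) (S : Set (Fin d → ℝ))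

open Classical in
/-- The predicate on words that holds for the codes of the balls with property `P`. -/
noncomputable def ballName (P : (Fin d → ℝ) → ℝ → Prop) : StrFun := fun s =>
  [decide (∃ (p : Fin d → ℤ × ℕ) (n : ℤ), s = queryCode p n ∧ P (ptVal p) ((2 : ℝ) ^ (-n)))]

theorem ballName_eq (P : (Fin d → ℝ) → ℝ → Prop) (s : Word) :
    ballName P s = [true] ∨ ballName P s = [false] := by
  have h : ∀ b : Bool, [b] = [true] ∨ [b] = [false] := by decide
  exact h _

theorem ballName_true {P : (Fin d → ℝ) → ℝ → Prop} {p : Fin d → ℤ × ℕ} {n : ℤ}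
    (h : P (ptVal p) ((2 : ℝ) ^ (-n))) : ballName P (queryCode p n) = [true] := by
  simp only [ballName, List.cons.injEq, decide_eq_true_eq, and_true]
  exact ⟨p, n, rfl, h⟩

theorem ballName_false {P : (Fin d → ℝ) → ℝ → Prop} {p : Fin d → ℤ × ℕ} {n : ℤ}
    (h : ¬ P (ptVal p) ((2 : ℝ) ^ (-n))) : ballName P (queryCode p n) = [false] := by
  simp only [ballName, List.cons.injEq, decide_eq_false_iff_not, and_true]
  rintro ⟨p', n', e, h'⟩
  obtain ⟨rfl, rfl⟩ := queryCode_injective e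
  exact h h'

theorem ballName_congr {P P' : (Fin d → ℝ) → ℝ → Prop} {s : Word}
    (h : ∀ (p : Fin d → ℤ × ℕ) (n : ℤ), s = queryCode p n →
      (P (ptVal p) ((2 : ℝ) ^ (-n)) ↔ P' (ptVal p) ((2 : ℝ) ^ (-n)))) :
    ballName P s = ballName P' s := by
  simp only [ballName, List.cons.injEq, and_true, decide_eq_decide]
  exact ⟨fun ⟨p, n, e, h'⟩ => ⟨p, n, e, (h p n e).1 h'⟩,
    fun ⟨p, n, e, h'⟩ => ⟨p, n, e, (h p n e).2 h'⟩⟩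

/-- The canonical weak-membership name. -/
noncomputable def wname : StrFun := ballName fun x r => N.closedBall x r ⊆ S

/-- The canonical name for the set representation. -/
noncomputable def sname : StrFun := ballName fun x r => (N.ball x r ∩ S).Nonempty

variable {N S}

theorem wname_isName (hS : S ∈ regularSets d) : (wmemRep N).IsName (wname N S) S 0 := by
  refine ⟨hS, rfl, ballName_eq _, fun p n => ⟨fun h => ballName_true h, fun h => ?_⟩⟩
  refine ballName_false fun h' => ?_
  have hmem : ptVal p ∈ N.closedBall (ptVal p) ((2 : ℝ) ^ (-n)) := by
    simp [zpow_nonneg]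
  exact Set.disjoint_left.1 h hmem (h' hmem)

theorem sname_isName (hS : S ∈ closedSets d) : (setRep N).IsName (sname N S) S 0 := by
  refine ⟨hS, rfl, ballName_eq _, fun p n => ⟨fun h => ballName_true h, fun h => ?_⟩⟩
  refine ballName_false ?_
  rintro ⟨y, hy, hyS⟩
  refine Set.disjoint_left.1 h ?_ hyS
  have h1 : N (y - ptVal p) < 2 ^ (-n) := hy
  refine h1.le.trans ?_
  exact zpow_le_zpow_right₀ one_le_two (by omega)

/-- A small ball can be added to a set without a change of finitely many values of the
weak-membership name. -/
theorem wname_union_closedBall (hd : 1 ≤ d) (hN : WellBehaved N) (hS : IsClosed S)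
    {x : Fin d → ℝ} {δ : ℝ} (hδ : 0 < δ) (hdis : Disjoint S (N.closedBall x δ))
    (I : Finset Word) :
    ∃ ε, 0 < ε ∧ ε ≤ δ ∧ ∀ s ∈ I, wname N (S ∪ N.closedBall x ε) s = wname N S s := by
  -- `ε` is chosen below the radii of all queried balls.
  have h1 : ∃ ε, 0 < ε ∧ ε ≤ δ ∧ ∀ s ∈ I, ∀ (p : Fin d → ℤ × ℕ) (n : ℤ), s = queryCode p n →
      ε < (2 : ℝ) ^ (-n) := by
    induction I using Finset.induction_on with
    | empty => exact ⟨δ, hδ, le_rfl, by simp⟩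
    | insert s I _ ih =>
      obtain ⟨ε, hε, hεδ, h⟩ := ih
      by_cases hs : ∃ (p : Fin d → ℤ × ℕ) (n : ℤ), s = queryCode p n
      · obtain ⟨p, n, rfl⟩ := hs
        have h2 : (0 : ℝ) < 2 ^ (-n) := zpow_pos two_pos _
        refine ⟨min ε (2 ^ (-n) / 2), lt_min hε (half_pos h2), (min_le_left _ _).trans hεδ, ?_⟩
        intro s' hs' p' n' e
        rcases Finset.mem_insert.1 hs' with rfl | hs'
        · obtain ⟨rfl, rfl⟩ := queryCode_injective e
          exact (min_le_right _ _).trans_lt (half_lt_self h2)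
        · exact (min_le_left _ _).trans_lt (h s' hs' p' n' e)
      · refine ⟨ε, hε, hεδ, fun s' hs' p' n' e => ?_⟩
        rcases Finset.mem_insert.1 hs' with rfl | hs'
        · exact absurd ⟨p', n', e⟩ hs
        · exact h s' hs' p' n' e
  obtain ⟨ε, hε, hεδ, h⟩ := h1
  refine ⟨ε, hε, hεδ, fun s hs => ballName_congr fun p n e =>
    ⟨fun hsub => ?_, fun hsub => hsub.trans Set.subset_union_left⟩⟩
  have hdis' : Disjoint S (N.closedBall x ε) :=
    hdis.mono_right fun y hy => (show N (y - x) ≤ ε from hy).trans hεδ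
  -- A connected ball inside two disjoint closed sets lies in one of them, and it does not fit into
  -- the small ball.
  have hpre : IsPreconnected (N.closedBall (ptVal p) ((2 : ℝ) ^ (-n))) :=
    (N.convex_closedBall _ _).isPreconnected
  rcases isPreconnected_iff_subset_of_disjoint_closed.1 hpre _ _ hS (isClosed_closedBall N x ε)
    hsub (by rw [hdis'.inter_eq, Set.inter_empty]) with h' | h'
  · exact h'
  · exact absurd (radius_le_of_subset hd hN (zpow_nonneg zero_le_two _) h')
      (not_le.2 (h s hs p n e))

/-- A remote ball can be added to a set without a change of finitely many values of the name for
the set representation. -/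
theorem sname_union_closedBall (N : Seminorm ℝ (Fin d → ℝ)) (S : Set (Fin d → ℝ))
    (I : Finset Word) :
    ∃ R : ℝ, ∀ x, R ≤ N x → ∀ s ∈ I, sname N (S ∪ N.closedBall x 1) s = sname N S s := by
  -- Beyond `R`, a ball of radius 1 is out of reach of every queried ball.
  have h1 : ∃ R : ℝ, ∀ s ∈ I, ∀ (p : Fin d → ℤ × ℕ) (n : ℤ), s = queryCode p n →
      N (ptVal p) + (2 : ℝ) ^ (-n) + 1 ≤ R := by
    induction I using Finset.induction_on with
    | empty => exact ⟨0, by simp⟩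
    | insert s I _ ih =>
      obtain ⟨R, h⟩ := ih
      by_cases hs : ∃ (p : Fin d → ℤ × ℕ) (n : ℤ), s = queryCode p n
      · obtain ⟨p, n, rfl⟩ := hs
        refine ⟨max R (N (ptVal p) + (2 : ℝ) ^ (-n) + 1), ?_⟩
        intro s' hs' p' n' e
        rcases Finset.mem_insert.1 hs' with rfl | hs'
        · obtain ⟨rfl, rfl⟩ := queryCode_injective e
          exact le_max_right _ _
        · exact (h s' hs' p' n' e).trans (le_max_left _ _)
      · refine ⟨R, fun s' hs' p' n' e => ?_⟩
        rcases Finset.mem_insert.1 hs' with rfl | hs'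
        · exact absurd ⟨p', n', e⟩ hs
        · exact h s' hs' p' n' e
  obtain ⟨R, hR⟩ := h1
  refine ⟨R, fun x hx s hs => ballName_congr fun p n e => ⟨?_, fun h =>
    h.mono (Set.inter_subset_inter_right _ Set.subset_union_left)⟩⟩
  rintro ⟨y, hy, hyS | hyx⟩
  · exact ⟨y, hy, hyS⟩
  · exfalso
    have h2 : N (y - ptVal p) < 2 ^ (-n) := hy
    have h3 : N (y - x) ≤ 1 := hyx
    have h4 := hR s hs p n e
    have h5 : N x ≤ N (y - x) + N (y - ptVal p) + N (ptVal p) := by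
      have : x = -(y - x) + (y - ptVal p) + ptVal p := by abel
      calc N x = N (-(y - x) + (y - ptVal p) + ptVal p) := by rw [← this]
        _ ≤ N (-(y - x)) + N (y - ptVal p) + N (ptVal p) :=
          (map_add_le_add N _ _).trans (add_le_add_left (map_add_le_add N _ _) _)
        _ = _ := by rw [map_neg_eq_map]
    linarith

end Names

/-! ### An outer radius is discontinuous -/

/-- At even positions the sequence `(0 1)^k' 1^ω` shows 0 until the tail of ones begins. A single
letter 1 there bounds the coded number. -/
theorem unaryBit_le {k k' : ℕ} (h : unaryBit k' (2 * k) = true) : k' ≤ k := by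
  by_contra hlt
  simp [unaryBit, show k < k' by omega] at h

theorem unaryBit_self (k : ℕ) : unaryBit k (2 * k) = true := by simp [unaryBit]

/-- A continuous function depends on finitely many values of its argument at each point. -/
theorem ContinuousOn.exists_finset {g : StrFun → StrFun} {D : Set StrFun} (hg : ContinuousOn g D)
    {φ : StrFun} (hφ : φ ∈ D) (s : Word) :
    ∃ I : Finset Word, ∀ ψ ∈ D, (∀ u ∈ I, ψ u = φ u) → g ψ s = g φ s := by
  have := discreteTopology_word
  have h1 : ContinuousWithinAt (fun ψ => g ψ s) D φ :=
    ((continuous_apply s).continuousAt).comp_continuousWithinAt (hg φ hφ)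
  have h2 : (fun ψ => g ψ s) ⁻¹' {g φ s} ∈ nhdsWithin φ D :=
    h1 (by simp [nhds_discrete])
  obtain ⟨U, hU, hsub⟩ := mem_nhdsWithin_iff_exists_mem_nhds_inter.1 h2
  rw [nhds_pi, Filter.mem_pi] at hU
  obtain ⟨I, hI, V, hV, hVU⟩ := hU
  refine ⟨hI.toFinset, fun ψ hψ h => hsub ⟨hVU fun u hu => ?_, hψ⟩⟩
  rw [h u (by simpa using hu)]
  exact mem_of_mem_nhds (hV u)

section Bound

variable {d : ℕ} {N : Seminorm ℝ (Fin d → ℝ)}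

/-- The hypothesis `hloc` says that arbitrarily remote balls can be added unnoticed by finitely many
queries. One letter of the result for the unit ball depends on finitely many queries and bounds the
outer radius for all the enlarged bodies at once, since the inner ball given as advice stays valid.
-/
theorem not_isContinuous_bound (hN : WellBehaved N) {ρ : Rep (Set (Fin d → ℝ))}
    {nm : Set (Fin d → ℝ) → StrFun} (hnm : ∀ S ∈ KR d, ρ.IsName (nm S) S 0)
    (hloc : ∀ (I : Finset Word) (R : ℝ), ∃ x ε, 0 < ε ∧ ε ≤ 1 ∧ R < N x ∧
      ∀ s ∈ I, nm (N.closedBall 0 1 ∪ N.closedBall x ε) s = nm (N.closedBall 0 1) s) :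
    ¬ IsContinuous ((ρ.restrict (KR d)).enrich (enrAR N)) unaryRep (Bound N) := by
  rintro ⟨g, hg, hcont⟩
  let w : Word := wordPair (ptCode fun _ : Fin d => ((0 : ℤ), 0)) (unInt 0)
  have hw : ∀ T, w ∈ enrAR N (N.closedBall 0 1 ∪ T) := fun T =>
    ⟨_, 0, by
      rw [ptVal_zero]
      simpa using (ball_subset_closedBall 0 1).trans Set.subset_union_left, rfl⟩
  have hball : ∀ x {ε : ℝ}, 0 < ε → N.closedBall x ε ∈ KR d := fun x ε hε =>
    (closedBall_mem_KCR hN x hε).1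
  have hname : ∀ S ∈ KR d, w ∈ enrAR N S →
      ((ρ.restrict (KR d)).enrich (enrAR N)).IsName (strPair (nm S) fun _ => w) S (0 + w.length) :=
    fun S hS hwS => Rep.enrich_isName ⟨hS, hnm S hS⟩ hwS
  have hbd : ∀ S ∈ KR d, (Bound N S).Nonempty := by
    intro S hS
    obtain ⟨R, hR⟩ := hS.2.bddAbove_image (continuous_seminorm N).continuousOn
    obtain ⟨k, hk⟩ := pow_unbounded_of_one_lt R (one_lt_two (α := ℝ))
    refine ⟨k, fun y hy => ?_⟩
    rw [Seminorm.mem_closedBall, sub_zero, zpow_natCast]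
    exact (hR ⟨y, hy, rfl⟩).trans hk.le
  let S₀ := N.closedBall (0 : Fin d → ℝ) 1
  have hS₀ : S₀ ∈ KR d := hball 0 one_pos
  have hw₀ : w ∈ enrAR N S₀ := by simpa using hw ∅
  obtain ⟨b, -, _, hb, -⟩ := hg _ S₀ _ (hname S₀ hS₀ hw₀) (hbd S₀ hS₀)
  -- The first even position at which the name of `b` shows the letter 1.
  let s : Word := List.replicate (2 * intCode b) false
  have hs : s.length = 2 * intCode b := List.length_replicate
  obtain ⟨I, hI⟩ := ContinuousOn.exists_finset hcont (φ := strPair (nm S₀) fun _ => w)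
    ⟨_, S₀, hname S₀ hS₀ hw₀, hbd S₀ hS₀⟩ s
  obtain ⟨x, ε, hε, -, hx, hag⟩ := hloc (I.image List.tail) (2 ^ intCode b)
  have hS : S₀ ∪ N.closedBall x ε ∈ KR d := union_mem_KR hS₀ (hball x hε)
  have hn := hname _ hS (hw _)
  obtain ⟨b', hb'S, _, hb', -⟩ := hg _ _ _ hn (hbd _ hS)
  have heq := hI _ ⟨_, _, hn, hbd _ hS⟩ fun u hu =>
    strPair_congr _ (hag _ (Finset.mem_image_of_mem _ hu))
  rw [hb, hb', hs, unaryBit_self] at heq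
  have hle := unaryBit_le (by simpa using heq)
  have hxb : N x ≤ 2 ^ b' := by
    have := hb'S (Set.mem_union_right S₀ (show x ∈ N.closedBall x ε by simpa using hε.le))
    simpa using this
  have h2 : (2 : ℝ) ^ b' ≤ 2 ^ intCode b := by
    rw [← zpow_natCast]
    refine zpow_le_zpow_right₀ one_le_two ?_
    have := natAbs_le_intCode b'
    omega
  linarith

theorem not_isContinuous_bound_wmem (hd : 1 ≤ d) (hN : WellBehaved N) :
    ¬ IsContinuous (((wmemRep N).restrict (KR d)).enrich (enrAR N)) unaryRep (Bound N) := by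
  refine not_isContinuous_bound hN (fun S hS => wname_isName hS.1) fun I R => ?_
  obtain ⟨p, hp⟩ := exists_dyadic_point_ge hd hN (max (R + 1) 3)
  have h1 := (le_max_left _ _).trans hp
  have h2 := (le_max_right _ _).trans hp
  have hdis : Disjoint (N.closedBall 0 1) (N.closedBall (ptVal p) 1) := by
    refine Set.disjoint_left.2 fun y hy hy' => ?_
    have h3 : N y ≤ 1 := by simpa using hy
    have h4 : N (y - ptVal p) ≤ 1 := hy'
    have h5 : N (ptVal p) ≤ N y + N (y - ptVal p) := by
      have := map_sub_le_add N y (y - ptVal p)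
      simpa using this
    linarith
  obtain ⟨ε, hε, hε1, h⟩ := wname_union_closedBall hd hN (isClosed_closedBall N 0 1) one_pos hdis I
  exact ⟨_, ε, hε, hε1, by linarith, h⟩

theorem not_isContinuous_bound_setRep (hd : 1 ≤ d) (hN : WellBehaved N) :
    ¬ IsContinuous (((setRep N).restrict (KR d)).enrich (enrAR N)) unaryRep (Bound N) := by
  refine not_isContinuous_bound hN (fun S hS => sname_isName hS.1.1) fun I R => ?_
  obtain ⟨R', hR'⟩ := sname_union_closedBall N (N.closedBall 0 1) I
  obtain ⟨p, hp⟩ := exists_dyadic_point_ge hd hN (max (R + 1) R')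
  have h1 := (le_max_left _ _).trans hp
  exact ⟨_, 1, one_pos, le_rfl, by linarith, hR' _ ((le_max_right _ _).trans hp)⟩

/-- Weak membership with all advice does not give the distance function. -/
theorem not_reduces_dist (hd : 1 ≤ d) (hN : WellBehaved N) :
    ¬ Reduces ((((wmemRep N).restrict (KR d)).enrich (enrAR N)).enrich (enrB N))
        ((distRep N).restrict (KR d)) := by
  rintro ⟨g, M, hg, hM⟩
  -- The distance of `q` is at least 3 from the unit ball and 0 from the enlarged body. At precision
  -- 0 errors are at most 1, so no answer serves both.
  obtain ⟨q, hq⟩ := exists_dyadic_point_ge hd hN 4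
  obtain ⟨k, hk⟩ := pow_unbounded_of_one_lt (N (ptVal q) + 1) (one_lt_two (α := ℝ))
  let w : Word := wordPair (ptCode fun _ : Fin d => ((0 : ℤ), 0)) (unInt 0)
  let w' : Word := unInt k
  let S₀ := N.closedBall (0 : Fin d → ℝ) 1
  have hw : ∀ T, w ∈ enrAR N (S₀ ∪ T) := fun T =>
    ⟨_, 0, by
      rw [ptVal_zero]
      simpa using (ball_subset_closedBall 0 1).trans Set.subset_union_left, rfl⟩
  have hS₀ : S₀ ∈ KR d := (closedBall_mem_KCR hN 0 one_pos).1
  have hw' : ∀ ε ≤ (1 : ℝ), w' ∈ enrB N (S₀ ∪ N.closedBall (ptVal q) ε) := by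
    refine fun ε hε => ⟨k, ?_, rfl⟩
    rintro y (hy | hy)
    · have h1 : N y ≤ 1 := by simpa [S₀] using hy
      rw [Seminorm.mem_closedBall, sub_zero, zpow_natCast]
      linarith
    · have h1 : N (y - ptVal q) ≤ ε := hy
      have h2 : N y ≤ N (y - ptVal q) + N (ptVal q) := by
        simpa using map_add_le_add N (y - ptVal q) (ptVal q)
      rw [Seminorm.mem_closedBall, sub_zero, zpow_natCast]
      linarith
  let nm : Set (Fin d → ℝ) → StrFun := fun S =>
    strPair (strPair (wname N S) fun _ => w) fun _ => w'
  have hname : ∀ S ∈ KR d, w ∈ enrAR N S → w' ∈ enrB N S →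
      ((((wmemRep N).restrict (KR d)).enrich (enrAR N)).enrich (enrB N)).IsName (nm S) S
        (0 + w.length + w'.length) := fun S hS h1 h2 =>
    Rep.enrich_isName (Rep.enrich_isName ⟨hS, wname_isName hS.1⟩ h1) h2
  have hw₀ : w ∈ enrAR N S₀ := by simpa using hw ∅
  have hw₀' : w' ∈ enrB N S₀ := by
    obtain ⟨b, hb, e⟩ := hw' 1 le_rfl
    exact ⟨b, Set.subset_union_left.trans hb, e⟩
  -- the answers of the machine about the distance of `q`
  let s : Word := queryCode q 0
  have hn₀ := hname S₀ hS₀ hw₀ hw₀'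
  obtain ⟨t, ht⟩ := hM _ _ ⟨S₀, hn₀, Set.singleton_nonempty _⟩ s
  obtain ⟨Q, -, hQ⟩ := M.exists_queries (nm S₀) s t
  have hdis : Disjoint S₀ (N.closedBall (ptVal q) 1) := by
    refine Set.disjoint_left.2 fun y hy hy' => ?_
    have h3 : N y ≤ 1 := by simpa [S₀] using hy
    have h4 : N (y - ptVal q) ≤ 1 := hy'
    have h5 : N (ptVal q) ≤ N y + N (y - ptVal q) := by
      have := map_sub_le_add N y (y - ptVal q)
      simpa using this
    linarith
  obtain ⟨ε, hε, hε1, hag⟩ := wname_union_closedBall hd hN (isClosed_closedBall N 0 1) one_pos hdis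
    -- Two letters are stripped because the name is paired with two pieces of advice.
    (Q.image fun u => u.tail.tail)
  let S₁ := S₀ ∪ N.closedBall (ptVal q) ε
  have hS₁ : S₁ ∈ KR d := union_mem_KR hS₀ (closedBall_mem_KCR hN _ hε).1
  have hn₁ := hname S₁ hS₁ (hw _) (hw' ε hε1)
  have hrun := hQ (nm S₁) fun u hu => strPair_congr _ (strPair_congr _
    (hag _ (Finset.mem_image_of_mem (fun u : Word => u.tail.tail) hu)))
  have hout : M.Outputs (nm S₁) s (g (nm S₀) s) :=
    ⟨t, by rw [OracleTM.OutputsWithin, hrun]; exact ht⟩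
  have heq := OracleTM.outputs_unique hout (hM _ _ ⟨S₁, hn₁, Set.singleton_nonempty _⟩ s)
  obtain ⟨_, rfl, _, h0⟩ := hg _ S₀ _ hn₀ (Set.singleton_nonempty _)
  obtain ⟨_, rfl, _, h1⟩ := hg _ S₁ _ hn₁ (Set.singleton_nonempty _)
  obtain ⟨v, hv, -, hv'⟩ := h0.2.2.2 q 0
  obtain ⟨u, hu, -, hu'⟩ := h1.2.2.2 q 0
  have huv : v = u := dyCode_injective (by rw [← hv, ← hu]; exact heq)
  subst huv
  have hd0 : 3 ≤ distTo N S₀ (ptVal q) := by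
    refine le_csInf (hS₀.1.1.2.image _) ?_
    rintro _ ⟨y, hy, rfl⟩
    have h3 : N y ≤ 1 := by simpa [S₀] using hy
    have h5 : N (ptVal q) ≤ N (ptVal q - y) + N y := by
      simpa using map_add_le_add N (ptVal q - y) y
    change 3 ≤ N (ptVal q - y)
    linarith
  have hd1 : distTo N S₁ (ptVal q) ≤ 0 := by
    refine csInf_le ⟨0, ?_⟩ ⟨ptVal q, Or.inr (by simpa using hε.le), by simp⟩
    rintro _ ⟨y, -, rfl⟩
    exact apply_nonneg N _
  simp only [neg_zero, zpow_zero] at hv' hu'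
  have := (abs_le.1 hv').1
  have := (abs_le.1 hu').2
  linarith

end Bound

end SetRep

namespace SetRep

/-! ### Lower bounds on the time to find advice parameters -/

section LowerBounds

variable {d : ℕ} {N : Seminorm ℝ (Fin d → ℝ)}

theorem apply_zero_closedBall {x : Fin d → ℝ} {r : ℝ} : x ∈ N.closedBall 0 r ↔ N x ≤ r := by
  simp

theorem exists_dyadic_near (x : Fin d → ℝ) {ε : ℝ} (hε : 0 < ε) :
    ∃ p : Fin d → ℤ × ℕ, N (ptVal p - x) < ε := by
  obtain ⟨C, hC, h⟩ := exists_norm_upper_bound N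
  obtain ⟨m, hm⟩ := exists_pow_lt_of_lt_one (div_pos hε hC) (one_half_lt_one (α := ℝ))
  refine ⟨fun i => (⌊2 ^ m * x i⌋, m), (h _).trans_lt ?_⟩
  rw [lt_div_iff₀ hC, mul_comm] at hm
  refine lt_of_le_of_lt (mul_le_mul_of_nonneg_left ?_ hC.le) hm
  refine (pi_norm_le_iff_of_nonneg (by positivity)).2 fun i => ?_
  have h2 : (0 : ℝ) < 2 ^ m := by positivity
  have h3 := Int.floor_le (2 ^ m * x i)
  have h4 := Int.lt_floor_add_one (2 ^ m * x i)
  rw [Pi.sub_apply, Real.norm_eq_abs, abs_le, one_div, inv_pow]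
  simp only [ptVal, dyVal]
  have e : (⌊2 ^ m * x i⌋ : ℝ) / 2 ^ m - x i = (⌊2 ^ m * x i⌋ - 2 ^ m * x i) * (2 ^ m)⁻¹ := by
    field_simp
  have h5 : (0 : ℝ) < (2 ^ m)⁻¹ := by positivity
  rw [e]
  constructor <;> nlinarith

theorem enrA_nonempty {x : Fin d → ℝ} {r : ℝ} (hr : 0 < r) {S : Set (Fin d → ℝ)}
    (h : N.closedBall x r ⊆ S) : (enrA N S).Nonempty := by
  obtain ⟨p, hp⟩ := exists_dyadic_near (N := N) x (half_pos hr)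
  refine ⟨_, p, ⟨r / 2, half_pos hr, fun y hy => h ?_⟩, rfl⟩
  have h1 : N (y - ptVal p) ≤ r / 2 := hy
  have h2 : N (y - x) ≤ N (y - ptVal p) + N (ptVal p - x) := by
    simpa using map_add_le_add N (y - ptVal p) (ptVal p - x)
  rw [Seminorm.mem_closedBall]
  linarith

/-- The advice length `ℓ` is the same along the family, so the running time on the empty input, and
with it the output length, stays bounded. -/
theorem not_isPolyTime_of_length {ρ : Rep (Set (Fin d → ℝ))} {E : Set (Fin d → ℝ) → Set Word}
    {ℓ : ℕ} (φ : ℕ → StrFun) (S : ℕ → Set (Fin d → ℝ)) (hname : ∀ m, ρ.IsName (φ m) (S m) ℓ)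
    (hne : ∀ m, (E (S m)).Nonempty) (hlen : ∀ m, ∀ w ∈ E (S m), m ≤ w.length) :
    ¬ IsPolyTime ρ wordRep E := by
  intro h
  obtain ⟨B, hB⟩ := h.exists_length_le ℓ
  obtain ⟨w, hw, hwB⟩ := hB _ _ (hname (B + 1)) (hne _)
  have := hlen _ w hw
  omega

/-- A family of balls along which the values of an advice parameter, other than the inner point,
get long. -/
noncomputable def ballFamily (N : Seminorm ℝ (Fin d → ℝ)) : Advice → ℕ → Set (Fin d → ℝ)
  | Advice.b, m => N.closedBall 0 (2 ^ (m : ℤ))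
  | _, m => N.closedBall 0 (2 ^ (-(m : ℤ)))

/-- An advice word that is valid along the families of balls. -/
def originAdvice (d : ℕ) : Advice → Word
  | Advice.a => ptCode fun _ : Fin d => ((0 : ℤ), 0)
  | _ => unInt 0

theorem ballFamily_mem_KCR (hN : WellBehaved N) (χ : Advice) (m : ℕ) :
    ballFamily N χ m ∈ KCR d := by
  cases χ <;> exact closedBall_mem_KCR hN 0 (zpow_pos two_pos _)

theorem originAdvice_mem {χ χ' : Advice} (hχ : χ' ≠ χ) (hχa : χ ≠ Advice.a) (m : ℕ) :
    originAdvice d χ' ∈ χ'.enr N (ballFamily N χ m) := by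
  have hle : (1 : ℝ) ≤ 2 ^ (m : ℤ) := one_le_zpow₀ one_le_two (by omega)
  have hle' : (2 : ℝ) ^ (-(m : ℤ)) ≤ 1 := zpow_le_one_of_nonpos₀ one_le_two (by omega)
  cases χ' with
  | a =>
    cases χ with
    | a => exact absurd rfl hχ
    | r => exact ⟨_, ⟨_, zpow_pos two_pos _, by rw [ptVal_zero]; rfl⟩, rfl⟩
    | b => exact ⟨_, ⟨_, zpow_pos two_pos _, by rw [ptVal_zero]; rfl⟩, rfl⟩
  | r =>
    cases χ with
    | a => exact absurd rfl hχa
    | r => exact absurd rfl hχ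
    | b =>
      refine ⟨0, ⟨0, mem_interior_of_closedBall_subset (zpow_pos two_pos _) subset_rfl, ?_⟩, rfl⟩
      intro y hy
      rw [apply_zero_closedBall] at hy
      exact apply_zero_closedBall.2 (hy.trans (by simpa using hle))
  | b =>
    cases χ with
    | a => exact absurd rfl hχa
    | b => exact absurd rfl hχ
    | r =>
      refine ⟨0, ?_, rfl⟩
      intro y hy
      have h1 := apply_zero_closedBall.1 hy
      exact apply_zero_closedBall.2 (h1.trans (by simpa using hle'))

theorem enr_ballFamily_nonempty {χ : Advice} (hχa : χ ≠ Advice.a) (m : ℕ) :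
    (χ.enr N (ballFamily N χ m)).Nonempty := by
  cases χ with
  | a => exact absurd rfl hχa
  | r =>
    exact ⟨_, m, ⟨0, mem_interior_of_closedBall_subset (zpow_pos two_pos _) subset_rfl,
      subset_rfl⟩, rfl⟩
  | b => exact ⟨_, m, (subset_rfl : N.closedBall 0 (2 ^ (m : ℤ)) ⊆ _), rfl⟩

theorem le_length_of_mem_enr (hd : 1 ≤ d) (hN : WellBehaved N) {χ : Advice} (hχa : χ ≠ Advice.a)
    {m : ℕ} {w : Word} (hw : w ∈ χ.enr N (ballFamily N χ m)) : m ≤ w.length := by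
  have key : ∀ {k : ℤ}, (2 : ℝ) ^ (m : ℤ) ≤ 2 ^ k → m ≤ (unInt k).length := by
    intro k hk
    rw [length_unInt]
    have h1 := (zpow_le_zpow_iff_right₀ (one_lt_two (α := ℝ))).1 hk
    have := natAbs_le_intCode k
    omega
  cases χ with
  | a => exact absurd rfl hχa
  | r =>
    obtain ⟨r, ⟨x, -, hx⟩, rfl⟩ := hw
    have h1 := radius_le_of_subset hd hN (zpow_nonneg zero_le_two _) hx
    refine key ?_
    rw [zpow_neg, zpow_neg] at h1
    exact (inv_le_inv₀ (zpow_pos two_pos _) (zpow_pos two_pos _)).1 h1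
  | b =>
    obtain ⟨b, hb, rfl⟩ := hw
    exact key (radius_le_of_subset hd hN (zpow_nonneg zero_le_two _) hb)

/-- Concentric balls about the origin: growing ones force long outer radius parameters, shrinking
ones long inner radius parameters, while fixed words remain valid for the other two parameters. -/
theorem not_isPolyTime_radius (hd : 1 ≤ d) (hN : WellBehaved N) {χ₁ χ₂ χ₃ : Advice}
    (h13 : χ₁ ≠ χ₃) (h23 : χ₂ ≠ χ₃) (h3 : χ₃ ≠ Advice.a) :
    ¬ IsPolyTime ((((wmemRep N).restrict (KCR d)).enrich (χ₁.enr N)).enrich (χ₂.enr N))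
      wordRep (χ₃.enr N) :=
  not_isPolyTime_of_length _ (ballFamily N χ₃)
    (fun m => Rep.enrich_isName (Rep.enrich_isName ⟨ballFamily_mem_KCR hN χ₃ m,
      wname_isName (ballFamily_mem_KCR hN χ₃ m).1.1⟩ (originAdvice_mem h13 h3 m))
      (originAdvice_mem h23 h3 m))
    (enr_ballFamily_nonempty h3) fun _ _ => le_length_of_mem_enr hd hN h3

/-! ### The adversary argument for inner points -/

theorem exists_eval_lt_two_pow (P : Polynomial ℕ) : ∃ n, P.eval n < 2 ^ n := by
  have h : Filter.Tendsto (fun n : ℕ => ((P.eval n : ℕ) : ℝ) / 2 ^ n) Filter.atTop (nhds 0) := by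
    induction P using Polynomial.induction_on' with
    | add p q hp hq =>
      have := hp.add hq
      simpa [add_div] using this
    | monomial k a =>
      have := (tendsto_pow_const_div_const_pow_of_one_lt k (one_lt_two (α := ℝ))).const_mul (a : ℝ)
      simpa [mul_div_assoc] using this
  obtain ⟨n, hn⟩ := (h.eventually (gt_mem_nhds one_pos)).exists
  refine ⟨n, ?_⟩
  rw [div_lt_one (by positivity)] at hn
  exact_mod_cast hn

/-- Equally spaced points on a line. -/
noncomputable def linePt (v : Fin d → ℝ) (r k : ℕ) : Fin d → ℝ := ((4 * k : ℝ) / 2 ^ r) • v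

/-- The centres are spaced by four radii, so the balls are disjoint and a point identifies its ball.
-/
theorem linePt_eq_of_mem {v : Fin d → ℝ} (hv : N v = 1) {r k k' : ℕ} {y : Fin d → ℝ}
    (h : y ∈ N.closedBall (linePt v r k) (2 ^ (-(r : ℤ))))
    (h' : y ∈ N.closedBall (linePt v r k') (2 ^ (-(r : ℤ)))) : k = k' := by
  rw [Seminorm.mem_closedBall, zpow_neg, zpow_natCast] at h h'
  have h1 : N (linePt v r k' - linePt v r k) ≤ (2 ^ r)⁻¹ + (2 ^ r)⁻¹ := by
    have := map_sub_le_add N (y - linePt v r k) (y - linePt v r k')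
    rw [sub_sub_sub_cancel_left] at this
    linarith
  rw [linePt, linePt, apply_sub_smul hv, ← sub_div, abs_div, abs_of_pos (a := (2 : ℝ) ^ r)
    (by positivity), div_le_iff₀ (by positivity), add_mul, inv_mul_cancel₀ (by positivity)] at h1
  have h2 : |(4 * k' : ℤ) - 4 * k| ≤ 1 + 1 := by exact_mod_cast h1
  rw [abs_le] at h2
  omega

/-- The advice consists of both radius parameters and is the same for all `2 ^ r` balls, with length
linear in `r`. On the run in which every query is denied, each ball must contain the centre of some
query or the point that is output; disjointness gives at most `T + 1` balls, which is less than `2 ^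
r`. -/
theorem not_isPolyTime_point (hd : 1 ≤ d) (hN : WellBehaved N) {χ₁ χ₂ : Advice}
    (h12 : χ₁ ≠ χ₂) (h1 : χ₁ ≠ Advice.a) (h2 : χ₂ ≠ Advice.a) :
    ¬ IsPolyTime ((((wmemRep N).restrict (KCR d)).enrich (χ₁.enr N)).enrich (χ₂.enr N))
      wordRep (enrA N) := by
  classical
  intro h
  obtain ⟨M, τ, hM⟩ := h.exists_run
  obtain ⟨v, hv⟩ := exists_unit_vector hd hN
  -- The advice has length `2 * r + 6`; the summand 1 accounts for the output in addition to the
  -- queries.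
  obtain ⟨r, hr⟩ := exists_eval_lt_two_pow (τ.comp (2 * Polynomial.X + 6) + 1)
  let S : ℕ → Set (Fin d → ℝ) := fun k => N.closedBall (linePt v r k) (2 ^ (-(r : ℤ)))
  have hS : ∀ k, S k ∈ KCR d := fun k => closedBall_mem_KCR hN _ (zpow_pos two_pos _)
  let adv : Advice → Word := fun χ => match χ with
    | Advice.a => []
    | Advice.r => unInt r
    -- The centres have norm at most 4 and the radii are at most 1, so `2 ^ 3` suffices.
    | Advice.b => unInt 3
  have hadv : ∀ χ ≠ Advice.a, ∀ k < 2 ^ r, adv χ ∈ χ.enr N (S k) := by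
    intro χ hχ k hk
    cases χ with
    | a => exact absurd rfl hχ
    | r =>
      exact ⟨r, ⟨_, mem_interior_of_closedBall_subset (zpow_pos two_pos _) subset_rfl,
        subset_rfl⟩, rfl⟩
    | b =>
      refine ⟨3, fun y hy => ?_, rfl⟩
      have e1 : N (y - linePt v r k) ≤ 2 ^ (-(r : ℤ)) := hy
      have e2 : (2 : ℝ) ^ (-(r : ℤ)) ≤ 1 := zpow_le_one_of_nonpos₀ one_le_two (by omega)
      have e3 : N (linePt v r k) ≤ 4 := by
        rw [linePt, apply_smul hv, abs_of_nonneg (by positivity), div_le_iff₀ (by positivity)]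
        have : (k : ℝ) ≤ 2 ^ r := by exact_mod_cast hk.le
        linarith
      have e4 : N y ≤ N (y - linePt v r k) + N (linePt v r k) := by
        simpa using map_add_le_add N (y - linePt v r k) (linePt v r k)
      rw [apply_zero_closedBall]
      norm_num
      linarith
  have hlen : (adv χ₁).length + (adv χ₂).length = 2 * r + 6 := by
    have e1 : (unInt r).length = 2 * r := by rw [length_unInt, intCode_natCast]
    have e2 : (unInt 3).length = 6 := by rw [length_unInt]; rfl
    cases χ₁ <;> cases χ₂ <;> simp_all [adv]
    omega
  let nm : StrFun → StrFun := fun φ => strPair (strPair φ fun _ => adv χ₁) fun _ => adv χ₂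
  let T := τ.eval (2 * r + 6)
  have hrun : ∀ k < 2 ^ r, ∃ w ∈ enrA N (S k), M.OutputsWithin (nm (wname N (S k))) [] w T := by
    intro k hk
    have := hM _ (S k) _ (Rep.enrich_isName (Rep.enrich_isName ⟨hS k, wname_isName (hS k).1.1⟩
      (hadv χ₁ h1 k hk)) (hadv χ₂ h2 k hk)) (enrA_nonempty (zpow_pos two_pos _) subset_rfl)
    rwa [zero_add, hlen] at this
  obtain ⟨Q, hQ, hagree⟩ := M.exists_queries (nm fun _ => [false]) [] T
  -- each query, and the output, rules out at most one of the balls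
  have hkill : ∀ k < 2 ^ r, ∃ o ∈ Finset.insertNone Q, ∃ p : Fin d → ℤ × ℕ, ptVal p ∈ S k ∧
      (∀ u, o = some u → ∃ n, u.tail.tail = queryCode p n) ∧
      (o = none → ((M.step (nm fun _ => [false]))^[T] (M.init [])).stk (Sum.inl 1) =
        (ptCode p : List Bool)) := by
    intro k hk
    -- Either some query would be affirmed for ball `k`, and then its centre lies in the ball, or
    -- the denying run is the true run and its output is an inner point.
    by_cases hex : ∃ u ∈ Q, wname N (S k) u.tail.tail = [true]
    · obtain ⟨u, hu, hut⟩ := hex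
      simp only [wname, ballName, List.cons.injEq, decide_eq_true_eq, and_true] at hut
      obtain ⟨p, n, e, hpn⟩ := hut
      refine ⟨some u, by simpa using hu, p, hpn (by simp [zpow_nonneg]), ?_, by simp⟩
      rintro _ ⟨⟩
      exact ⟨n, e⟩
    · push Not at hex
      obtain ⟨_, ⟨p, ⟨δ, hδ, hp⟩, rfl⟩, hw⟩ := hrun k hk
      have e := hagree (nm (wname N (S k))) fun u hu => strPair_congr _ (strPair_congr _
        ((ballName_eq _ _).resolve_left (hex u hu)))
      refine ⟨none, by simp, p, hp (by simpa using hδ.le), by simp, fun _ => ?_⟩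
      rw [← e]
      exact hw.2
  choose! f hf p hp hp1 hp2 using hkill
  have hinj : Set.InjOn f (Finset.range (2 ^ r)) := by
    intro k hk k' hk' e
    have hk : k < 2 ^ r := by simpa using hk
    have hk' : k' < 2 ^ r := by simpa using hk'
    have hpp : p k = p k' := by
      rcases ho : f k with _ | u
      · exact ptCode_injective ((hp2 k hk ho).symm.trans (hp2 k' hk' (e ▸ ho)))
      · obtain ⟨n, hn⟩ := hp1 k hk u ho
        obtain ⟨n', hn'⟩ := hp1 k' hk' u (e ▸ ho)
        exact (queryCode_injective (hn.symm.trans hn')).1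
    exact linePt_eq_of_mem hv (hp k hk) (hpp ▸ hp k' hk')
  have hcard := Finset.card_le_card_of_injOn f (fun k hk => hf k (by simpa using hk)) hinj
  rw [Finset.card_range, Finset.card_insertNone] at hcard
  have e : (τ.comp (2 * Polynomial.X + 6) + 1).eval r = T + 1 := by
    simp [T, Polynomial.eval_comp]
  omega

/-- No advice parameter is computable in polynomial time from the other two. -/
theorem not_isPolyTime_advice (hd : 1 ≤ d) (hN : WellBehaved N) (χ₁ χ₂ χ₃ : Advice)
    (h12 : χ₁ ≠ χ₂) (h13 : χ₁ ≠ χ₃) (h23 : χ₂ ≠ χ₃) :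
    ¬ IsPolyTime ((((wmemRep N).restrict (KCR d)).enrich (χ₁.enr N)).enrich (χ₂.enr N))
      wordRep (χ₃.enr N) := by
  by_cases h3 : χ₃ = Advice.a
  · subst h3
    exact not_isPolyTime_point hd hN h12 h13 h23
  · exact not_isPolyTime_radius hd hN h13 h23 h3

/-- No advice parameter is computable in polynomial time from the set representation. -/
theorem not_isPolyTime_setRep (hd : 1 ≤ d) (hN : WellBehaved N) (χ : Advice) :
    ¬ IsPolyTime ((setRep N).restrict (KCR d)) wordRep (χ.enr N) := by
  by_cases hχ : χ = Advice.a
  · subst hχ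
    intro h
    obtain ⟨B, hB⟩ := h.exists_length_le 0
    obtain ⟨v, hv⟩ := exists_unit_vector hd hN
    let S : ℕ → Set (Fin d → ℝ) := fun k => N.closedBall (linePt v 0 k) (2 ^ (-((0 : ℕ) : ℤ)))
    have hS : ∀ k, S k ∈ KCR d := fun k => closedBall_mem_KCR hN _ (zpow_pos two_pos _)
    have hw : ∀ k, ∃ w ∈ enrA N (S k), w.length ≤ B := fun k =>
      hB _ (S k) ⟨hS k, sname_isName (hS k).1.1.1⟩ (enrA_nonempty (zpow_pos two_pos _) subset_rfl)
    choose f hf hfB using hw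
    have hfin : {w : Word | w.length ≤ B}.Finite := List.finite_length_le Bool B
    -- Infinitely many disjoint balls need different inner points, but there are only finitely many
    -- words of bounded length.
    refine Set.infinite_of_injective_forall_mem (f := f) (fun k k' e => ?_) hfB hfin
    obtain ⟨p, ⟨δ, hδ, hp⟩, e1⟩ := hf k
    obtain ⟨p', ⟨δ', hδ', hp'⟩, e2⟩ := hf k'
    obtain rfl : p = p' := ptCode_injective (by rw [← e1, ← e2, e])
    exact linePt_eq_of_mem hv (hp (show N (ptVal p - ptVal p) ≤ δ by simpa using hδ.le))
      (hp' (show N (ptVal p - ptVal p) ≤ δ' by simpa using hδ'.le))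
  · exact not_isPolyTime_of_length _ (ballFamily N χ)
      (fun m => ⟨ballFamily_mem_KCR hN χ m, sname_isName (ballFamily_mem_KCR hN χ m).1.1.1⟩)
      (enr_ballFamily_nonempty hχ) fun _ _ => le_length_of_mem_enr hd hN hχ

end LowerBounds

end SetRep

namespace SetRep

/-! ### The advice parameters are computable from the set representation -/

/-- A word that depends in a primitive recursive way on an index. -/
def PrimrecWord (q : ℕ → Word) : Prop := ∃ f : ℕ → ℕ, Primrec f ∧ ∀ i, q i = natToWord (f i)

/-- The expected answers `e` at index `i` form a certificate for the value `G i`: `hex` says that a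
certificate occurs, `hE` that it is sound. The least certified index may depend on the name, which a
multi-valued operation allows. -/
theorem isComputable_of_search {X ι : Type} [Finite ι] {ρ : Rep X} {E : X → Set Word}
    (q : ι → ℕ → Word) (hq : ∀ j, PrimrecWord (q j)) (e : ι → Bool) (G : ℕ → Word)
    (hG : PrimrecWord G)
    (hρ : ∀ φ x ℓ, ρ.IsName φ x ℓ → ∀ s, φ s = [true] ∨ φ s = [false])
    (hex : ∀ φ x ℓ, ρ.IsName φ x ℓ → ∃ i, ∀ j, φ (q j i) = [e j])
    (hE : ∀ φ x ℓ, ρ.IsName φ x ℓ → ∀ i, (∀ j, φ (q j i) = [e j]) → G i ∈ E x) :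
    IsComputable ρ wordRep E := by
  classical
  have := Fintype.ofFinite ι
  choose f hf hqf using hq
  obtain ⟨G', hG', hGG'⟩ := hG
  let l : List ι := Finset.univ.toList
  have hl : ∀ j, ∃ (k : ℕ) (hk : k < l.length), l[k] = j := fun j =>
    List.getElem_of_mem (Finset.mem_toList.2 (Finset.mem_univ j))
  obtain ⟨M, hM⟩ := exists_search_machine (l.map f) (l.map e) G'
    (by simpa using fun j _ => hf j) hG'
  let g : StrFun → StrFun := fun φ _ =>
    if h : ∃ i, ∀ j, φ (q j i) = [e j] then G (Nat.find h) else []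
  refine ⟨g, M, fun φ x ℓ hx _ => ?_, ?_⟩
  · have h := hex φ x ℓ hx
    have hg : ∀ s, g φ s = G (Nat.find h) := fun s => dif_pos h
    exact ⟨G (Nat.find h), hE φ x ℓ hx _ (Nat.find_spec h), 0, hg, rfl⟩
  · rintro φ ℓ ⟨x, hx, _⟩ s
    have h := hex φ x ℓ hx
    have hg : g φ s = natToWord (G' (Nat.find h)) := (dif_pos h).trans (hGG' _)
    rw [hg]
    have htab : ∀ (k : ℕ) (hk : k < l.length) (i : ℕ),
        natToWord (tableFun (l.map f) k i) = q l[k] i ∧ (l.map e).getD k false = e l[k] := by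
      intro k hk i
      refine ⟨?_, by simp [hk]⟩
      rw [tableFun_eq _ _ (by simpa using hk), List.getElem_map, ← hqf]
    refine hM φ (hρ φ x ℓ hx) _ (fun k hk => ?_) (fun i hi => ?_) s
    · have hk : k < l.length := by simpa using hk
      rw [(htab k hk _).1, (htab k hk 0).2]
      exact Nat.find_spec h _
    · have := Nat.find_min h hi
      push Not at this
      obtain ⟨j, hj⟩ := this
      obtain ⟨k, hk, rfl⟩ := hl j
      refine ⟨k, by simpa using hk, ?_⟩
      rw [(htab k hk _).1, (htab k hk 0).2]
      exact hj

theorem primrec_intCode_mul_sub_add {a x y : ℕ → ℕ} (ha : Primrec a) (hx : Primrec x)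
    (hy : Primrec y) (w : ℤ) : Primrec fun i => intCode (a i * w + ((x i : ℤ) - y i)) := by
  refine (primrec_intCode_sub
    (Primrec.nat_add.comp (Primrec.nat_mul.comp ha (.const w.toNat)) hx)
    (Primrec.nat_add.comp (Primrec.nat_mul.comp ha (.const (-w).toNat)) hy)).of_eq fun i => ?_
  congr 1
  push_cast
  have h := Int.toNat_sub_toNat_neg w
  calc _ = (a i : ℤ) * ((w.toNat : ℤ) - (-w).toNat) + ((x i : ℤ) - y i) := by ring
    _ = _ := by rw [h]

theorem primrecWord_query {d : ℕ} {p : ℕ → Fin d → ℤ × ℕ} {n : ℕ → ℤ}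
    (h1 : ∀ j, Primrec fun i => intCode (p i j).1) (h2 : ∀ j, Primrec fun i => (p i j).2)
    (hn : Primrec fun i => intCode (n i)) : PrimrecWord fun i => queryCode (p i) (n i) :=
  primrec_queryNum h1 h2 hn

theorem primrecWord_unInt {n : ℕ → ℕ} (hn : Primrec n) : PrimrecWord fun i => unInt (n i) :=
  ⟨_, primrec_mersenne (Primrec.nat_mul.comp (.const 2) hn), fun i => by
    rw [← intCode_natCast, ← unInt_eq]⟩

section Computable

variable {d : ℕ} {N : Seminorm ℝ (Fin d → ℝ)}

theorem setRep_true {φ : StrFun} {S : Set (Fin d → ℝ)} {ℓ : ℕ} (h : (setRep N).IsName φ S ℓ)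
    {p : Fin d → ℤ × ℕ} {n : ℤ} (hφ : φ (queryCode p n) = [true]) :
    ∃ y ∈ S, N (y - ptVal p) ≤ 2 ^ (-n + 1) := by
  by_contra hc
  push Not at hc
  have := (h.2.2.2 p n).2 (Set.disjoint_left.2 fun y hy hyS => (hc y hyS).not_ge hy)
  simp [hφ] at this

theorem setRep_false {φ : StrFun} {S : Set (Fin d → ℝ)} {ℓ : ℕ} (h : (setRep N).IsName φ S ℓ)
    {p : Fin d → ℤ × ℕ} {n : ℤ} (hφ : φ (queryCode p n) = [false]) {y : Fin d → ℝ} (hy : y ∈ S) :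
    2 ^ (-n) ≤ N (y - ptVal p) := by
  by_contra hc
  push Not at hc
  have := (h.2.2.2 p n).1 ⟨y, hc, hy⟩
  simp [hφ] at this

/-- The integer points of the boundary of a cube, and the origin. -/
def cubePts (d R : ℕ) : Set (Fin d → ℤ) :=
  {z | (∀ i, |z i| ≤ R) ∧ (z = 0 ∨ ∃ i, |z i| = R)}

theorem finite_cubePts (d R : ℕ) : (cubePts d R).Finite :=
  (Set.finite_Icc (fun _ : Fin d => -(R : ℤ)) fun _ => (R : ℤ)).subset fun _ hz =>
    ⟨fun i => (abs_le.1 (hz.1 i)).1, fun i => (abs_le.1 (hz.1 i)).2⟩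

/-- Each point of the boundary of a cube is close to an integer point of the boundary. -/
theorem exists_cubePt (hd : 1 ≤ d) {R : ℕ} (hR : R ≠ 0) {x : Fin d → ℝ} (hx : ‖x‖ = R) :
    ∃ z ∈ cubePts d R, z ≠ 0 ∧ ‖x - fun i => (z i : ℝ)‖ ≤ 1 / 2 := by
  have hle : ∀ i, |round (x i)| ≤ (R : ℤ) := by
    intro i
    have h1 : |x i| ≤ R := hx ▸ norm_le_pi_norm x i
    have h2 := abs_le.1 (abs_sub_round (x i))
    obtain ⟨h3, h4⟩ := abs_le.1 h1
    have h5 : (round (x i) : ℝ) < R + 1 := by linarith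
    have h6 : (-(R : ℝ) - 1) < round (x i) := by linarith
    have h5' : round (x i) < (R : ℤ) + 1 := by exact_mod_cast h5
    have h6' : -(R : ℤ) - 1 < round (x i) := by exact_mod_cast h6
    rw [abs_le]
    omega
  have : Nonempty (Fin d) := ⟨⟨0, hd⟩⟩
  obtain ⟨i, hi⟩ : ∃ i, ‖x i‖ = R := by
    obtain ⟨i, hi⟩ := Finite.exists_max fun i => ‖x i‖
    exact ⟨i, le_antisymm (hx ▸ norm_le_pi_norm x i)
      (hx ▸ (pi_norm_le_iff_of_nonneg (norm_nonneg _)).2 hi)⟩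
  have hzi : |round (x i)| = (R : ℤ) := by
    rcases (abs_eq (Nat.cast_nonneg R)).1 hi with h | h
    · rw [h, round_natCast, Nat.abs_cast]
    · have e : x i = ((-(R : ℤ) : ℤ) : ℝ) := by rw [h]; push_cast; rfl
      rw [e, round_intCast, abs_neg, Nat.abs_cast]
  refine ⟨fun i => round (x i), ⟨hle, Or.inr ⟨i, hzi⟩⟩, fun h0 => ?_,
    (pi_norm_le_iff_of_nonneg (by norm_num)).2 fun j => abs_sub_round (x j)⟩
  have := congrFun h0 i
  simp only [Pi.zero_apply] at this
  rw [this] at hzi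
  simp at hzi
  exact hR (by exact_mod_cast hzi.symm)

/-- The cube of radius `R` is scaled by `2 ^ k` until the set is seen near the origin and denied at
all grid points of the boundary. The balls denied cover the boundary, so the connected set stays
inside the cube. -/
theorem isComputable_outer_radius (hd : 1 ≤ d) (hN : WellBehaved N) :
    IsComputable ((setRep N).restrict (KCR d)) wordRep (enrB N) := by
  obtain ⟨c, C, hc, hC, hcC⟩ := exists_norm_bounds hN
  obtain ⟨K, hK⟩ := pow_unbounded_of_one_lt C (one_lt_two (α := ℝ))
  -- In units of `2 ^ k`, the queried radius is `2 ^ K` and its double is `2 ^ (K + 1)`; the summand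
  -- 1 is room for the set itself once `2 ^ k` exceeds its norm bound.
  obtain ⟨R, hR⟩ := exists_nat_gt ((2 ^ (K + 1) + 1) / c)
  rw [div_lt_iff₀ hc, mul_comm] at hR
  have hR0 : R ≠ 0 := by
    rintro rfl
    have : (0 : ℝ) < 2 ^ (K + 1) := by positivity
    simp at hR
    linarith
  obtain ⟨b, hb⟩ := pow_unbounded_of_one_lt (C * R) (one_lt_two (α := ℝ))
  have := (finite_cubePts d R).to_subtype
  let p : cubePts d R → ℕ → Fin d → ℤ × ℕ := fun z k i => (2 ^ k * z.1 i, 0)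
  have hp : ∀ z k, ptVal (p z k) = (2 : ℝ) ^ k • fun i => (z.1 i : ℝ) := by
    intro z k
    funext i
    simp [ptVal, dyVal, p]
  have hpow : ∀ k : ℕ, (2 : ℝ) ^ (-(-((K + k : ℕ) : ℤ))) = 2 ^ k * 2 ^ K := by
    intro k
    rw [neg_neg, zpow_natCast, pow_add, mul_comm]
  have hpow' : ∀ k : ℕ, (2 : ℝ) ^ (-(-((K + k : ℕ) : ℤ)) + 1) = 2 ^ k * 2 ^ (K + 1) := by
    intro k
    rw [zpow_add₀ two_ne_zero, hpow, zpow_one, pow_succ, mul_assoc]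
  have hs : ∀ k : ℕ, (0 : ℝ) < 2 ^ k := fun k => by positivity
  refine isComputable_of_search (fun z k => queryCode (p z k) (-((K + k : ℕ) : ℤ))) (fun z => ?_)
    (fun z => decide (z.1 = 0)) (fun k => unInt ((b + k : ℕ) : ℤ))
    (primrecWord_unInt (Primrec.nat_add.comp (.const b) .id))
    (fun φ S ℓ h => h.2.2.2.1) ?_ ?_
  · refine primrecWord_query (fun j => ?_) (fun j => .const 0) ?_
    · refine (primrec_intCode_mul_sub_add (primrec_two_pow .id) (.const 0) (.const 0)
        (z.1 j)).of_eq fun k => ?_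
      simp [p]
    · refine (primrec_intCode_sub (.const 0)
        (Primrec.nat_add.comp (.const K) .id)).of_eq fun k => ?_
      simp
  · rintro φ S ℓ ⟨hS, h⟩
    obtain ⟨B, hB⟩ := hS.1.2.bddAbove_image (continuous_seminorm N).continuousOn
    have hB : ∀ y ∈ S, N y ≤ B := fun y hy => hB ⟨y, hy, rfl⟩
    obtain ⟨k, hk⟩ := pow_unbounded_of_one_lt B (one_lt_two (α := ℝ))
    refine ⟨k, fun z => ?_⟩
    by_cases hz : z.1 = 0
    · rw [decide_eq_true hz]
      refine (h.2.2.2 _ _).1 ?_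
      obtain ⟨y, hy⟩ := hS.1.1.1.2
      refine ⟨y, ?_, hy⟩
      have e : (fun i => (z.1 i : ℝ)) = 0 := by funext i; simp [hz]
      rw [Seminorm.mem_ball, hp, hpow, e, smul_zero, sub_zero]
      have : (1 : ℝ) ≤ 2 ^ K := one_le_pow₀ one_le_two
      nlinarith [hB y hy, hs k]
    · rw [decide_eq_false hz]
      refine (h.2.2.2 _ _).2 (Set.disjoint_left.2 fun y hy hyS => ?_)
      rw [Seminorm.mem_closedBall, hp, hpow'] at hy
      obtain ⟨i, hi⟩ := z.2.2.resolve_left hz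
      have h1 : (R : ℝ) ≤ ‖fun i => (z.1 i : ℝ)‖ := by
        have h2 := norm_le_pi_norm (fun i => (z.1 i : ℝ)) i
        rw [Real.norm_eq_abs, ← Int.cast_abs, hi] at h2
        simpa using h2
      have h2 := (hcC fun i => (z.1 i : ℝ)).1
      have h3 : N ((2 : ℝ) ^ k • fun i => (z.1 i : ℝ)) ≤
          N y + N (y - (2 : ℝ) ^ k • fun i => (z.1 i : ℝ)) := by
        simpa using map_sub_le_add N y (y - (2 : ℝ) ^ k • fun i => (z.1 i : ℝ))
      rw [map_smul_eq_mul, Real.norm_of_nonneg (hs k).le] at h3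
      have h4 := hB y hyS
      have h5 : 2 ^ (K + 1) + 1 < N fun i => (z.1 i : ℝ) :=
        hR.trans_le ((mul_le_mul_of_nonneg_left h1 hc.le).trans h2)
      nlinarith [hs k]
  · rintro φ S ℓ ⟨hS, h⟩ k hk
    have h0 : (0 : Fin d → ℤ) ∈ cubePts d R := ⟨fun i => by simp, Or.inl rfl⟩
    have hin : ∃ y ∈ S, ‖y‖ < 2 ^ k * R := by
      obtain ⟨y, hy, hyN⟩ := setRep_true h ((hk ⟨0, h0⟩).trans (by simp))
      refine ⟨y, hy, ?_⟩
      have e : (fun i => (((0 : Fin d → ℤ) i : ℤ) : ℝ)) = 0 := by funext i; simp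
      rw [hp, hpow', e, smul_zero, sub_zero] at hyN
      have h1 := (hcC y).1
      have h2 := hs k
      by_contra hcon
      push Not at hcon
      have h3 := mul_le_mul_of_nonneg_left hcon hc.le
      nlinarith
    -- A boundary point is within `2 ^ k / 2` of a grid point in maximum norm, hence strictly within
    -- `2 ^ k * 2 ^ K` in `N` since `C < 2 ^ K`; a negative answer excludes this.
    have hne : ∀ x ∈ S, ‖x‖ ≠ 2 ^ k * R := by
      intro x hx hxR
      have hk0 := (hs k).ne'
      obtain ⟨z, hz, hz0, hxz⟩ := exists_cubePt hd hR0 (x := ((2 : ℝ) ^ k)⁻¹ • x) (by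
        rw [norm_smul, hxR, norm_inv, Real.norm_of_nonneg (hs k).le,
          inv_mul_cancel_left₀ hk0])
      have h1 := setRep_false h ((hk ⟨z, hz⟩).trans (by simp [hz0])) hx
      rw [hp, hpow] at h1
      have e : x - (2 : ℝ) ^ k • (fun i => (z i : ℝ)) =
          (2 : ℝ) ^ k • (((2 : ℝ) ^ k)⁻¹ • x - fun i => (z i : ℝ)) := by
        rw [smul_sub, smul_inv_smul₀ hk0]
      rw [e, map_smul_eq_mul, Real.norm_of_nonneg (hs k).le] at h1
      have h2 := le_of_mul_le_mul_left h1 (hs k)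
      have h3 := (hcC (((2 : ℝ) ^ k)⁻¹ • x - fun i => (z i : ℝ))).2
      nlinarith [mul_le_mul_of_nonneg_left hxz hC.le]
    refine ⟨_, fun x hx => ?_, rfl⟩
    obtain ⟨y, hy, hyR⟩ := hin
    have hlt : ‖x‖ < 2 ^ k * R := by
      by_contra hcon
      push Not at hcon
      obtain ⟨u, hu, hu'⟩ := hS.2.isPreconnected.intermediate_value hy hx
        continuous_norm.continuousOn ⟨hyR.le, hcon⟩
      exact hne u hu hu'
    rw [Seminorm.mem_closedBall, sub_zero, zpow_natCast, pow_add]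
    have h1 := (hcC x).2
    have h2 := mul_le_mul_of_nonneg_left hlt.le hC.le
    nlinarith [hs k]

/-- If a convex closed set comes close to the vertices of a cross-polytope, then it contains a
ball around its centre. -/
theorem closedBall_subset_of_near_vertices (hd : 1 ≤ d) {c : ℝ} (hc : 0 < c)
    (hcN : ∀ x, c * ‖x‖ ≤ N x) {S : Set (Fin d → ℝ)} (hS : IsClosed S) (hconv : Convex ℝ S)
    {a : Fin d → ℝ} {s R : ℝ} (hs : 0 < s) (hR : 3 * d / c ≤ R)
    (h : ∀ (l : Fin d) (b : Bool), ∃ y ∈ S,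
      N (y - (a + (s * (if b then R else -R)) • Pi.single l (1 : ℝ))) ≤ 2 * s) :
    N.closedBall a s ⊆ S := by
  intro z hz
  by_contra hzS
  obtain ⟨f, u, hfu, hu⟩ := geometric_hahn_banach_closed_point hconv hS hzS
  -- `F` bounds the separating functional with respect to the maximum norm.
  let F := ∑ l, |f (Pi.single l 1)|
  have hf : ∀ x, |f x| ≤ F * ‖x‖ := by
    intro x
    have e : f x = ∑ l, x l * f (Pi.single l 1) := by
      conv_lhs => rw [← Finset.univ_sum_single x]
      rw [map_sum]
      refine Finset.sum_congr rfl fun l _ => ?_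
      have : (Pi.single l (x l) : Fin d → ℝ) = x l • Pi.single l 1 := by
        rw [← Pi.single_smul]; simp
      rw [this, map_smul, smul_eq_mul]
    rw [e, Finset.sum_mul]
    refine (Finset.abs_sum_le_sum_abs _ _).trans (Finset.sum_le_sum fun l _ => ?_)
    rw [abs_mul, mul_comm]
    exact mul_le_mul_of_nonneg_left (norm_le_pi_norm x l) (abs_nonneg _)
  have hF : 0 ≤ F := Finset.sum_nonneg fun l _ => abs_nonneg _
  have hfN : ∀ x t, N x ≤ t → |f x| ≤ F * (t / c) := by
    intro x t hx
    refine (hf x).trans (mul_le_mul_of_nonneg_left ?_ hF)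
    rw [le_div_iff₀ hc, mul_comm]
    exact (hcN x).trans hx
  have hza := (abs_le.1 (hfN (z - a) s hz)).2
  have hR0 : 0 ≤ R := le_trans (by positivity) hR
  -- For each axis the vertex on which `f` is larger is used. The errors are `2 * s` at the vertex
  -- and `s` at `z`, whence the factor 3; summing over the axes contradicts `hR`.
  have key : ∀ l, R * |f (Pi.single l 1)| < 3 * F / c := by
    intro l
    obtain ⟨y, hy, hyN⟩ := h l (decide (0 ≤ f (Pi.single l 1)))
    have h1 := (abs_le.1 (hfN _ _ hyN)).1
    have h2 := (hfu y hy).trans hu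
    have e : s * (if decide (0 ≤ f (Pi.single l 1)) = true then R else -R) * f (Pi.single l 1) =
        s * (R * |f (Pi.single l 1)|) := by
      by_cases h0 : 0 ≤ f (Pi.single l 1)
      · simp [h0, abs_of_nonneg]; ring
      · rw [if_neg (by simpa using h0), abs_of_neg (not_le.1 h0)]; ring
    rw [map_sub, map_add, map_smul, smul_eq_mul, e] at h1
    rw [map_sub] at hza
    have h3 : s * (R * |f (Pi.single l 1)|) < s * (3 * F / c) := by
      have e3 : s * (3 * F / c) = F * (s / c) + F * (2 * s / c) := by ring
      rw [e3]
      linarith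
    exact lt_of_mul_lt_mul_left h3 hs.le
  have hsum : R * F < d * (3 * F / c) := by
    have h1 : ∑ l, R * |f (Pi.single l 1)| < ∑ _l : Fin d, 3 * F / c :=
      Finset.sum_lt_sum_of_nonempty ⟨⟨0, hd⟩, Finset.mem_univ _⟩ fun l _ => key l
    rwa [← Finset.mul_sum, Finset.sum_const, Finset.card_univ, Fintype.card_fin,
      nsmul_eq_mul] at h1
  have e : (d : ℝ) * (3 * F / c) = 3 * d / c * F := by ring
  rw [e] at hsum
  exact absurd (mul_le_mul_of_nonneg_right hR hF) (not_le.2 hsum)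

/-- The entries of the finite sequences that are coded by a number. -/
def entry : ℕ → ℕ → ℕ
  | 0, i => i.unpair.1
  | t + 1, i => entry t i.unpair.2

theorem primrec_entry (t : ℕ) : Primrec (entry t) := by
  induction t with
  | zero => exact Primrec.fst.comp Primrec.unpair
  | succ t ih => exact ih.comp (Primrec.snd.comp Primrec.unpair)

theorem exists_entry_eq (n : ℕ) (f : ℕ → ℕ) : ∃ i, ∀ t < n, entry t i = f t := by
  induction n generalizing f with
  | zero => exact ⟨0, by simp⟩
  | succ n ih =>
    obtain ⟨i, hi⟩ := ih fun t => f (t + 1)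
    refine ⟨Nat.pair (f 0) i, fun t ht => ?_⟩
    cases t with
    | zero => simp [entry]
    | succ t => simpa [entry] using hi t (by omega)

/-- The integer vectors that are coded by a number. -/
def intVec (d i : ℕ) (l : Fin d) : ℤ := (entry (2 * l + 1) i : ℤ) - entry (2 * l + 2) i

theorem exists_intVec_eq (m : ℕ) (z : Fin d → ℤ) : ∃ i, entry 0 i = m ∧ intVec d i = z := by
  -- Entry 0 holds `m`; the entries `2 * l + 1` and `2 * l + 2` hold the positive and the negative
  -- part of coordinate `l`.
  obtain ⟨i, hi⟩ := exists_entry_eq (2 * d + 1) fun t =>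
    if t = 0 then m else if h : (t - 1) / 2 < d then
      (if t % 2 = 1 then (z ⟨(t - 1) / 2, h⟩).toNat else (-z ⟨(t - 1) / 2, h⟩).toNat) else 0
  refine ⟨i, by simpa using hi 0 (by omega), funext fun l => ?_⟩
  have hl := l.2
  have e1 : (2 * (l : ℕ) + 1 - 1) / 2 = l := by omega
  have e2 : (2 * (l : ℕ) + 2 - 1) / 2 = l := by omega
  rw [intVec, hi _ (by omega), hi _ (by omega)]
  simp only [e1, e2, hl, dif_pos, Nat.add_eq_zero_iff, OfNat.ofNat_ne_zero, one_ne_zero, and_false,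
    if_false, Fin.eta]
  rw [if_pos (by omega), if_neg (by omega)]
  exact Int.toNat_sub_toNat_neg _

/-- The dyadic points that are coded by a number. -/
def centre (d i : ℕ) : Fin d → ℤ × ℕ := fun l => (intVec d i l, entry 0 i)

/-- The search runs over dyadic centres and precisions, with the vertices of a cross-polytope about
the centre as queries. A positive answer yields a point of the set within twice the queried radius,
as the separation argument needs. -/
theorem isComputable_of_inner_ball (hd : 1 ≤ d) (hN : WellBehaved N)
    {E : Set (Fin d → ℝ) → Set Word} (G : ℕ → Word) (hG : PrimrecWord G)
    (hE : ∀ S i, N.closedBall (ptVal (centre d i)) (2 ^ (-(entry 0 i : ℤ))) ⊆ S → G i ∈ E S) :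
    IsComputable ((setRep N).restrict (KCR d)) wordRep E := by
  obtain ⟨c, C, hc, -, hcC⟩ := exists_norm_bounds hN
  obtain ⟨R, hR⟩ := exists_nat_ge (3 * d / c)
  let sg : Bool → ℤ := fun b => if b then R else -R
  have hsg : ∀ b, (sg b : ℝ) = if b then (R : ℝ) else -R := by intro b; cases b <;> simp [sg]
  let p : Fin d × Bool → ℕ → Fin d → ℤ × ℕ := fun j i l =>
    (1 * (if l = j.1 then sg j.2 else 0) + intVec d i l, entry 0 i)
  have hp : ∀ j i, ptVal (p j i) = ptVal (centre d i) +
      ((2 : ℝ) ^ (-(entry 0 i : ℤ)) * (if j.2 then (R : ℝ) else -R)) • Pi.single j.1 (1 : ℝ) := by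
    intro j i
    funext l
    rw [← hsg, zpow_neg, zpow_natCast]
    by_cases hl : l = j.1
    · subst hl
      simp [ptVal, dyVal, p, centre]; ring
    · simp [ptVal, dyVal, p, centre, hl]
  refine isComputable_of_search (fun j i => queryCode (p j i) (entry 0 i)) (fun j => ?_)
    (fun _ => true) G hG (fun φ S ℓ h => h.2.2.2.1) ?_ ?_
  · refine primrecWord_query (fun l => ?_) (fun l => primrec_entry 0) ?_
    · exact (primrec_intCode_mul_sub_add (.const 1) (primrec_entry (2 * l + 1))
        (primrec_entry (2 * l + 2)) (if l = j.1 then sg j.2 else 0)).of_eq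
        fun i => by simp [p, intVec]
    · exact (Primrec.nat_mul.comp (.const 2) (primrec_entry 0)).of_eq fun i => rfl
  · rintro φ S ℓ ⟨hS, h⟩
    have hint : (interior S).Nonempty := by
      rw [Set.nonempty_iff_ne_empty]
      intro h0
      have h1 := hS.1.1.2
      rw [h0, closure_empty] at h1
      exact hS.1.1.1.2.ne_empty h1.symm
    obtain ⟨x, hx⟩ := hint
    obtain ⟨ε, hε, hxS⟩ := Metric.isOpen_iff.1 isOpen_interior x hx
    -- In units of `2 ^ (-m)` and in maximum norm, the vertices are `R` away from the centre and
    -- rounding moves the centre by at most 1, so all vertices fall into the interior.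
    obtain ⟨m, hm⟩ := exists_pow_lt_of_lt_one (div_pos hε (show (0 : ℝ) < R + 1 by positivity))
      (one_half_lt_one (α := ℝ))
    rw [lt_div_iff₀ (by positivity), one_div, inv_pow] at hm
    obtain ⟨i, rfl, hi⟩ := exists_intVec_eq m fun l => ⌊2 ^ m * x l⌋
    refine ⟨i, fun j => (h.2.2.2 _ _).1 ⟨ptVal (p j i), by simp,
      interior_subset (hxS ?_)⟩⟩
    rw [mem_ball_iff_norm]
    refine lt_of_le_of_lt ((pi_norm_le_iff_of_nonneg (by positivity)).2 fun l => ?_) hm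
    have h2 : (0 : ℝ) < 2 ^ entry 0 i := by positivity
    have h3 := Int.floor_le (2 ^ entry 0 i * x l)
    have h4 := Int.lt_floor_add_one (2 ^ entry 0 i * x l)
    have h5 : |((if l = j.1 then sg j.2 else 0 : ℤ) : ℝ)| ≤ R := by
      split_ifs
      · rw [hsg]; split_ifs <;> simp
      · simp
    obtain ⟨h6, h7⟩ := abs_le.1 h5
    have e : ptVal (p j i) l - x l = (2 ^ entry 0 i)⁻¹ *
        (((if l = j.1 then sg j.2 else 0 : ℤ) : ℝ) +
          (⌊2 ^ entry 0 i * x l⌋ - 2 ^ entry 0 i * x l)) := by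
      simp only [ptVal, dyVal, p, hi]
      push_cast
      field_simp
      ring
    rw [Pi.sub_apply, e, norm_mul, Real.norm_of_nonneg (by positivity), Real.norm_eq_abs]
    refine mul_le_mul_of_nonneg_left (abs_le.2 ⟨?_, ?_⟩) (by positivity) <;> linarith
  · rintro φ S ℓ ⟨hS, h⟩ i hi
    refine hE S i (closedBall_subset_of_near_vertices hd hc (fun x => (hcC x).1) hS.1.1.1.1 hS.2
      (zpow_pos two_pos _) hR fun l b => ?_)
    obtain ⟨y, hy, hyN⟩ := setRep_true h (hi (l, b))
    refine ⟨y, hy, ?_⟩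
    rw [hp, zpow_add₀ two_ne_zero, zpow_one] at hyN
    exact hyN.trans_eq (mul_comm _ _)

/-- Each advice parameter is computable from the set representation. -/
theorem isComputable_advice (hd : 1 ≤ d) (hN : WellBehaved N) (χ : Advice) :
    IsComputable ((setRep N).restrict (KCR d)) wordRep (χ.enr N) := by
  cases χ with
  | a =>
    refine isComputable_of_inner_ball hd hN (fun i => ptCode (centre d i))
      (primrec_ptNum (fun l => primrec_intCode_sub (primrec_entry _) (primrec_entry _))
        fun l => primrec_entry 0) fun S i h => ⟨_, ⟨_, zpow_pos two_pos _, h⟩, rfl⟩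
  | r =>
    exact isComputable_of_inner_ball hd hN (fun i => unInt (entry 0 i))
      (primrecWord_unInt (primrec_entry 0)) fun S i h =>
        ⟨_, ⟨_, mem_interior_of_closedBall_subset (zpow_pos two_pos _) h, h⟩, rfl⟩
  | b => exact isComputable_outer_radius hd hN

end Computable

end SetRep

/-! ### The proposition -/

theorem mainTheorem5 (d : ℕ) (hd : 1 ≤ d) (N : Seminorm ℝ (Fin d → ℝ)) (hN : WellBehaved N) :
    -- an outer radius is discontinuous, from weak membership and from `setRep`, with inner ball
    (¬ IsContinuous (((wmemRep N).restrict (KR d)).enrich (enrAR N)) unaryRep (Bound N) ∧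
      ¬ IsContinuous (((setRep N).restrict (KR d)).enrich (enrAR N)) unaryRep (Bound N)) ∧
    -- without convexity, all advice together does not give the distance function
    ¬ Reduces ((((wmemRep N).restrict (KR d)).enrich (enrAR N)).enrich (enrB N))
        ((distRep N).restrict (KR d)) ∧
    -- no advice parameter can be found in polynomial time from the other two
    (∀ χ₁ χ₂ χ₃ : Advice, χ₁ ≠ χ₂ → χ₁ ≠ χ₃ → χ₂ ≠ χ₃ →
      ¬ IsPolyTime ((((wmemRep N).restrict (KCR d)).enrich (χ₁.enr N)).enrich (χ₂.enr N))
          wordRep (χ₃.enr N)) ∧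
    -- each advice parameter is computable from `setRep`, but not in polynomial time
    (∀ χ : Advice, IsComputable ((setRep N).restrict (KCR d)) wordRep (χ.enr N)) ∧
    (∀ χ : Advice, ¬ IsPolyTime ((setRep N).restrict (KCR d)) wordRep (χ.enr N)) := by
  exact ⟨⟨not_isContinuous_bound_wmem hd hN, not_isContinuous_bound_setRep hd hN⟩,
    not_reduces_dist hd hN, not_isPolyTime_advice hd hN, isComputable_advice hd hN,
    not_isPolyTime_setRep hd hN⟩
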